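/- Let $\Gamma=\{\sum_{j=1}^d n_j\gamma_j : n_j\in\mathbb Z\}$ be the lattice generated by a basis $\gamma_1,\dots,\gamma_d$ of $\mathbb R^d$, let $\Gamma^*=\{k\in\mathbb R^d : k\cdot\gamma\in 2\pi\mathbb Z\ \ \forall \gamma\in\Gamma\}$ be its dual lattice, $Y^*=\{k : |k\cdot\gamma_j|\le\pi\ \ \forall j\}$ the centered fundamental domain of $\Gamma^*$, $\mathbb T^d=\mathbb R^d/\Gamma$, $\mathbb T^*_d=\mathbb R^d/\Gamma^*$ and $\mathcal H_{\rm f}=L^2(\mathbb T^d)$. For $\lambda\in\Gamma^*$ let $\tau(\lambda)$ be the unitary operator $(\tau(\lambda)f)(y)=e^{i\lambda\cdot y}f(y)$ on $\mathcal H_{\rm f}$. Put $$\mathcal H_\tau=\{\varphi\in L^2_{\rm loc}(\mathbb R^d,\mathcal H_{\rm f}) : \varphi(k-\lambda)=\tau(\lambda)\varphi(k)\ \ \forall\lambda\in\Gamma^*,\ \text{for a.e. } k\},$$ $$\widetilde{\mathcal W}=\mathcal H_\tau\cap L^2_{\rm loc}(\mathbb R^d,W^{2,2}(\mathbb T^d))\cap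 W^{1,2}_{\rm loc}(\mathbb R^d,L^2(\mathbb T^d)).$$ Let $\{P_*(k)\}_{k\in\mathbb R^d}$ be a family of orthogonal projectors on $\mathcal H_{\rm f}$ with $\dim \operatorname{Ran}P_*(k)=m<\infty$ for all $k$, such that * $(\tilde P_1)$ for some $\alpha>0$ the map $k\mapsto P_*(k)$ extends to a $\mathcal B(\mathcal H_{\rm f})$-valued analytic function on $\{\kappa\in\mathbb C^d : |\operatorname{Im}\kappa_j|<\alpha\ \ \forall j\}$; * $(P_2)$ $P_*(k+\lambda)=\tau(\lambda)^{-1}P_*(k)\tau(\lambda)$ for all $k\in\mathbb R^d$ and $\lambda\in\Gamma^*$. Let $\chi=\{\chi_1,\dots,\chi_m\}\subset\widetilde{\mathcal W}$ be a Bloch frame for this family, i.e. $\{\chi_1(k),\dots,\chi_m(k)\}$ is an orthonormal basis of $\operatorname{Ran}P_*(k)$ for a.e. $k\in Y^*$. Let $[A_j(k)]_{cb}=\langle\chi_c(k),\partial_{k_j}\chi_b(k)\rangle_{\mathcal H_{\rm f}}$ and, for $U\in W^{1,2}(\mathbb T^*_d;\mathcal U(m))$, let $$\tilde F_{MV}(U;\chi)=\sum_{j=1}^d\int_{\mathbb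 T^*_d}\Big[\operatorname{tr}\big(\partial_{k_j}U^*\,\partial_{k_j}U\big)+m\sum_{a=1}^m\|\partial_{k_j}\chi_a\|^2_{\mathcal H_{\rm f}}\Big]dk+\sum_{j=1}^d\int_{\mathbb T^*_d}\operatorname{tr}\big[(U\,\partial_{k_j}U^*-\partial_{k_j}U\,U^*)A_j\big]dk+\sum_{a=1}^m\sum_{j=1}^d\Big(\int_{\mathbb T^*_d}\big[U^*(\partial_{k_j}U+A_jU)\big]_{aa}\,dk\Big)^2,$$ a real number, where $dk$ is normalized so that $\int_{\mathbb T^*_d}dk=1$. Then there exists $U\in W^{1,2}(\mathbb T^*_d;\mathcal U(m))$ which minimizes $\tilde F_{MV}(\cdot\,;\chi)$ over $W^{1,2}(\mathbb T^*_d;\mathcal U(m))$. -/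

import Mathlib

open MeasureTheory
open scoped ContDiff Matrix InnerProductSpace

noncomputable section

namespace BlochMV

/-- Euclidean space `ℝ^d`. -/
abbrev Eu (d : ℕ) : Type := EuclideanSpace ℝ (Fin d)

/-! ### Local `L²` spaces, weak derivatives, local Sobolev spaces -/

section Sobolev

variable {d : ℕ} {F : Type*} [NormedAddCommGroup F] [NormedSpace ℝ F]

/-- `u ∈ L²_loc(ℝ^d, F)`. -/
def MemL2loc (u : Eu d → F) : Prop :=
  AEStronglyMeasurable u volume ∧
    ∀ K : Set (Eu d), IsCompact K → MemLp u 2 (volume.restrict K)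

/-- `v` is the weak (distributional) partial derivative `∂u/∂x_j` on `ℝ^d`. -/
def HasWeakPartial (j : Fin d) (u v : Eu d → F) : Prop :=
  LocallyIntegrable u volume ∧ LocallyIntegrable v volume ∧
    ∀ φ : Eu d → ℝ, ContDiff ℝ ∞ φ → HasCompactSupport φ →
      ∫ x, (fderiv ℝ φ x (EuclideanSpace.single j 1)) • u x = - ∫ x, φ x • v x

/-- `u ∈ W^{1,2}_loc(ℝ^d, F)`. -/
def MemW12loc (u : Eu d → F) : Prop :=
  MemL2loc u ∧ ∀ j : Fin d, ∃ v : Eu d → F, MemL2loc v ∧ HasWeakPartial j u v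

open Classical in
/-- The weak partial derivative `∂u/∂x_j`, unique up to equality almost everywhere whenever it
exists (and set to zero if it does not exist). -/
def weakPartial (j : Fin d) (u : Eu d → F) : Eu d → F :=
  if h : ∃ v, HasWeakPartial j u v then h.choose else 0

end Sobolev

/-! ### Lattices, tori and the fibre space -/

section Lattice

variable {d : ℕ} (b : Module.Basis (Fin d) ℝ (Eu d))

/-- The lattice `Γ` generated over `ℤ` by the basis vectors `γ_1, …, γ_d`. -/
def lattice : AddSubgroup (Eu d) := (Submodule.span ℤ (Set.range b)).toAddSubgroup

/-- The dual lattice `Γ* = {k : k · γ ∈ 2πℤ for all γ ∈ Γ}`. -/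
def dualLattice : AddSubgroup (Eu d) where
  carrier := {k | ∀ γ ∈ lattice b, ∃ n : ℤ, ⟪k, γ⟫_ℝ = 2 * Real.pi * n}
  zero_mem' := fun γ _ => ⟨0, by simp⟩
  add_mem' := by
    intro x y hx hy γ hγ
    obtain ⟨n, hn⟩ := hx γ hγ
    obtain ⟨p, hp⟩ := hy γ hγ
    exact ⟨n + p, by rw [inner_add_left, hn, hp]; push_cast; ring⟩
  neg_mem' := by
    intro x hx γ hγ
    obtain ⟨n, hn⟩ := hx γ hγ
    exact ⟨-n, by rw [inner_neg_left, hn]; push_cast; ring⟩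

/-- The centered fundamental domain `Y` of `Γ`. -/
def cell : Set (Eu d) := {x | ∀ j, b.repr x j ∈ Set.Icc (-(1 / 2) : ℝ) (1 / 2)}

/-- The centered fundamental domain `Y*` of `Γ*`: if `k = ∑ k'_j γ*_j` in the dual basis
(`γ*_j · γ_i = 2π δ_{ji}`), then `k · γ_j = 2π k'_j`, so that `k'_j ∈ [-1/2, 1/2]` means
`k · γ_j ∈ [-π, π]`. -/
def dualCell : Set (Eu d) := {k | ∀ j, ⟪k, b j⟫_ℝ ∈ Set.Icc (-Real.pi) Real.pi}

/-- The torus `𝕋^d = ℝ^d / Γ`. -/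
abbrev Torus : Type := Eu d ⧸ lattice b

/-- The dual torus `𝕋*_d = ℝ^d / Γ*`. -/
abbrev DualTorus : Type := Eu d ⧸ dualLattice b

/-- Lebesgue measure on the flat torus `𝕋^d`. -/
def torusMeasure : Measure (Torus b) :=
  (volume.restrict (cell b)).map (fun x : Eu d => (x : Torus b))

/-- The fibre Hilbert space `H_f = L²(𝕋^d)`. -/
abbrev Hf : Type := Lp ℂ 2 (torusMeasure b)

/-- For `l ∈ Γ*`, the function `y ↦ exp(i l · y)` on the torus `𝕋^d`. -/
def character (l : dualLattice b) : Torus b → ℂ :=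
  fun y => Quotient.liftOn' y
    (fun x : Eu d => Complex.exp (Complex.I * ((⟪(l : Eu d), x⟫_ℝ : ℝ) : ℂ))) (by
      intro x y hxy
      rw [QuotientAddGroup.leftRel_apply] at hxy
      obtain ⟨n, hn⟩ := l.2 _ hxy
      have h : ⟪(l : Eu d), y⟫_ℝ = ⟪(l : Eu d), x⟫_ℝ + 2 * Real.pi * n := by
        rw [← hn, ← inner_add_right]; congr 1; abel
      refine Complex.exp_eq_exp_iff_exists_int.2 ⟨-n, ?_⟩
      rw [h]; push_cast; ring)

lemma character_mk (l : dualLattice b) (x : Eu d) :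
    character b l (x : Torus b) =
      Complex.exp (Complex.I * ((⟪(l : Eu d), x⟫_ℝ : ℝ) : ℂ)) := rfl

lemma measurable_character (l : dualLattice b) : Measurable (character b l) := by
  refine measurable_from_quotient.2 ?_
  have : Continuous fun x : Eu d =>
      Complex.exp (Complex.I * ((⟪(l : Eu d), x⟫_ℝ : ℝ) : ℂ)) := by fun_prop
  exact this.measurable

lemma norm_character (l : dualLattice b) (y : Torus b) : ‖character b l y‖ = 1 := by
  induction y using QuotientAddGroup.induction_on with
  | H x => rw [character_mk, mul_comm]; exact Complex.norm_exp_ofReal_mul_I _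

lemma character_neg_mul (l : dualLattice b) (y : Torus b) :
    character b (-l) y * character b l y = 1 := by
  induction y using QuotientAddGroup.induction_on with
  | H x =>
    rw [character_mk, character_mk, ← Complex.exp_add]
    simp

lemma memLp_character_mul (l : dualLattice b) (f : Hf b) :
    MemLp (fun y => character b l y * f y) 2 (torusMeasure b) :=
  (Lp.memLp f).of_le
    ((measurable_character b l).aestronglyMeasurable.mul (Lp.memLp f).1)
    (Filter.Eventually.of_forall fun y => by simp [norm_character])

/-- Multiplication by `exp(i l · y)` on `L²(𝕋^d)`. -/
def tauFun (l : dualLattice b) (f : Hf b) : Hf b := (memLp_character_mul b l f).toLp _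

lemma coeFn_tauFun (l : dualLattice b) (f : Hf b) :
    tauFun b l f =ᵐ[torusMeasure b] fun y => character b l y * f y :=
  MemLp.coeFn_toLp _

lemma tauFun_neg (l : dualLattice b) (f : Hf b) : tauFun b (-l) (tauFun b l f) = f := by
  refine Lp.ext ?_
  filter_upwards [coeFn_tauFun b (-l) (tauFun b l f), coeFn_tauFun b l f] with y h1 h2
  rw [h1, h2, ← mul_assoc, character_neg_mul, one_mul]

/-- The unitary representation `τ` of `Γ*` on `H_f`: `(τ(l) f)(y) = exp(i l · y) f(y)`. -/
def tau (l : dualLattice b) : Hf b ≃ₗᵢ[ℂ] Hf b where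
  toFun := tauFun b l
  map_add' := by
    intro f g
    refine Lp.ext ?_
    filter_upwards [coeFn_tauFun b l (f + g), coeFn_tauFun b l f, coeFn_tauFun b l g,
      Lp.coeFn_add f g, Lp.coeFn_add (tauFun b l f) (tauFun b l g)] with y h1 h2 h3 h4 h5
    rw [h1, h5, Pi.add_apply, h2, h3, h4, Pi.add_apply, mul_add]
  map_smul' := by
    intro c f
    refine Lp.ext ?_
    filter_upwards [coeFn_tauFun b l (c • f), coeFn_tauFun b l f,
      Lp.coeFn_smul c f, Lp.coeFn_smul c (tauFun b l f)] with y h1 h2 h3 h4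
    rw [h1, RingHom.id_apply, h4, Pi.smul_apply, h2, h3, Pi.smul_apply, smul_eq_mul,
      smul_eq_mul]
    ring
  invFun := tauFun b (-l)
  left_inv := tauFun_neg b l
  right_inv := by
    intro f
    have h := tauFun_neg b (-l) f
    rwa [neg_neg] at h
  norm_map' := by
    intro f
    change ‖tauFun b l f‖ = ‖f‖
    rw [Lp.norm_def, Lp.norm_def]
    congr 1
    refine eLpNorm_congr_norm_ae ?_
    filter_upwards [coeFn_tauFun b l f] with y h
    rw [h, norm_mul, norm_character, one_mul]

/-! ### Families of projectors -/

/-- `k ↦ P(k)` is a family of orthogonal projectors on `H_f`, each with range of dimension `m`. -/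
def IsProjectorFamily (m : ℕ) (P : Eu d → (Hf b →L[ℂ] Hf b)) : Prop :=
  ∀ k, IsStarProjection (P k) ∧
    Module.rank ℂ (LinearMap.range (P k : Hf b →ₗ[ℂ] Hf b)) = (m : Cardinal)

/-- The strip `Ω_α = {κ ∈ ℂ^d : |Im κ_j| < α for all j}`. -/
def strip (d : ℕ) (α : ℝ) : Set (EuclideanSpace ℂ (Fin d)) := {κ | ∀ j, |(κ j).im| < α}

/-- Property `(P̃₁)`: the map `k ↦ P(k)` extends to a `B(H_f)`-valued analytic function on the
strip `Ω_α` for some `α > 0`. -/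
def HasAnalyticExtension (P : Eu d → (Hf b →L[ℂ] Hf b)) : Prop :=
  ∃ α : ℝ, 0 < α ∧ ∃ Q : EuclideanSpace ℂ (Fin d) → (Hf b →L[ℂ] Hf b),
    AnalyticOnNhd ℂ Q (strip d α) ∧
      ∀ k : Eu d, Q (WithLp.toLp 2 fun j => ((k j : ℝ) : ℂ)) = P k

/-- Property `(P₂)`: `P(k + l) = τ(l)⁻¹ P(k) τ(l)` for all `k ∈ ℝ^d` and `l ∈ Γ*`. -/
def IsTauCovariant (P : Eu d → (Hf b →L[ℂ] Hf b)) : Prop :=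
  ∀ (k : Eu d) (l : dualLattice b) (f : Hf b),
    P (k + l) f = (tau b l).symm (P k (tau b l f))

/-! ### The spaces `H_τ` and `W̃`, and Bloch frames -/

/-- `φ ∈ H_τ`: `φ ∈ L²_loc(ℝ^d, H_f)` and, for all `l ∈ Γ*`, `φ(k - l) = τ(l) φ(k)` for almost
every `k`. -/
def MemHtau (φ : Eu d → Hf b) : Prop :=
  MemL2loc φ ∧ ∀ l : dualLattice b, ∀ᵐ k : Eu d, φ (k - l) = tau b l (φ k)

/-- `g = ∂f/∂y_j` weakly on the torus `𝕋^d`, for `f, g ∈ L²(𝕋^d)`: the `Γ`-periodic lift of `g`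
is the weak derivative on `ℝ^d` of the `Γ`-periodic lift of `f`. -/
def HasTorusPartial (j : Fin d) (f g : Hf b) : Prop :=
  HasWeakPartial j (fun x : Eu d => f (x : Torus b)) (fun x : Eu d => g (x : Torus b))

/-- `φ ∈ L²_loc(ℝ^d, W^{2,2}(𝕋^d))`: `φ` and the fibrewise weak derivatives in `y` of orders one
and two are in `L²_loc(ℝ^d, L²(𝕋^d))`. -/
def MemL2locW22 (φ : Eu d → Hf b) : Prop :=
  MemL2loc φ ∧
    ∃ (g : Fin d → Eu d → Hf b) (h : Fin d → Fin d → Eu d → Hf b),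
      (∀ i, MemL2loc (g i)) ∧ (∀ i j, MemL2loc (h i j)) ∧
      ∀ᵐ k : Eu d, (∀ i, HasTorusPartial b i (φ k) (g i k)) ∧
        ∀ i j, HasTorusPartial b j (g i k) (h i j k)

/-- `φ ∈ W̃ = H_τ ∩ L²_loc(ℝ^d, W^{2,2}(𝕋^d)) ∩ W^{1,2}_loc(ℝ^d, L²(𝕋^d))`. -/
def MemWtilde (φ : Eu d → Hf b) : Prop :=
  MemHtau b φ ∧ MemL2locW22 b φ ∧ MemW12loc φ

/-- A Bloch frame for the family `P`: functions `χ_1, …, χ_m ∈ H_τ` with `P(k) χ_a(k) = χ_a(k)`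
and `χ_a(k) ≠ 0` such that `χ_1(k), …, χ_m(k)` is an orthonormal basis of the range of `P(k)`, for
almost every `k ∈ Y*`. -/
def IsBlochFrame {m : ℕ} (P : Eu d → (Hf b →L[ℂ] Hf b)) (χ : Fin m → Eu d → Hf b) : Prop :=
  (∀ a, MemHtau b (χ a)) ∧
    ∀ᵐ k ∂(volume.restrict (dualCell b)),
      (∀ a, P k (χ a k) = χ a k ∧ χ a k ≠ 0) ∧
      Orthonormal ℂ (fun a => χ a k) ∧
      Submodule.span ℂ (Set.range fun a => χ a k) =
        LinearMap.range (P k : Hf b →ₗ[ℂ] Hf b)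

/-! ### Gauges and the Marzari–Vanderbilt functional -/

/-- The `Γ*`-periodic lift to `ℝ^d` of a map `U : 𝕋*_d → U(m)`, as a matrix-valued map. -/
def gaugeLift {m : ℕ} (U : DualTorus b → Matrix.unitaryGroup (Fin m) ℂ) (k : Eu d) :
    Matrix (Fin m) (Fin m) ℂ := (U (k : DualTorus b)).1

/-- The set `W^{1,2}(𝕋*_d; U(m))`. -/
def gaugeSpace (m : ℕ) : Set (DualTorus b → Matrix.unitaryGroup (Fin m) ℂ) :=
  {U | ∀ p q, MemW12loc fun k => gaugeLift b U k p q}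

/-- The matrix `∂U/∂k_j`. -/
def gaugePartial {m : ℕ} (j : Fin d) (U : DualTorus b → Matrix.unitaryGroup (Fin m) ℂ)
    (k : Eu d) : Matrix (Fin m) (Fin m) ℂ :=
  Matrix.of fun p q => weakPartial j (fun k' => gaugeLift b U k' p q) k

/-- The matrix `[A_j(k)]_{cb} = ⟨χ_c(k), ∂χ_b/∂k_j(k)⟩`. -/
def berry {m : ℕ} (χ : Fin m → Eu d → Hf b) (j : Fin d) (k : Eu d) :
    Matrix (Fin m) (Fin m) ℂ :=
  Matrix.of fun p q => ⟪χ p k, weakPartial j (χ q) k⟫_ℂ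

/-- The complex number given by the formula for the localization functional in terms of the gauge
`U`. The integrals over the dual torus are taken over its fundamental domain `Y*`, with respect to
the normalized measure `dk / |Y*|`. -/
def mvFormula {m : ℕ} (χ : Fin m → Eu d → Hf b)
    (U : DualTorus b → Matrix.unitaryGroup (Fin m) ℂ) : ℂ :=
  (∑ j, ⨍ k in dualCell b,
      (((gaugePartial b j U k)ᴴ * gaugePartial b j U k).trace
        + (m : ℂ) * ∑ a, ((‖weakPartial j (χ a) k‖ ^ 2 : ℝ) : ℂ)))
  + (∑ j, ⨍ k in dualCell b,
      ((gaugeLift b U k * (gaugePartial b j U k)ᴴ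
        - gaugePartial b j U k * (gaugeLift b U k)ᴴ) * berry b χ j k).trace)
  + ∑ a, ∑ j, (⨍ k in dualCell b,
      ((gaugeLift b U k)ᴴ
        * (gaugePartial b j U k + berry b χ j k * gaugeLift b U k)) a a) ^ 2

/-- The localization functional `F̃_MV(U; χ)`. For `χ` a Bloch frame in `W̃` and
`U ∈ W^{1,2}(𝕋*_d; U(m))` the number `mvFormula b χ U` is real, because `U (∂U)ᴴ`, `A_j` and
`Uᴴ (∂U + A_j U)` are anti-Hermitian. -/
def mvFunctional {m : ℕ} (χ : Fin m → Eu d → Hf b)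
    (U : DualTorus b → Matrix.unitaryGroup (Fin m) ℂ) : ℝ :=
  (mvFormula b χ U).re

end Lattice

end BlochMV

end

/-!
The functional is bounded below and coercive only modulo a discrete symmetry. Multiplying a gauge
by a diagonal matrix of characters `e^{i k · γ_a}`, `γ_a ∈ Γ`, leaves it invariant: completing the
square in the derivative isolates a term whose shift cancels that of the squared averages
`∫ [Uᴴ (∂_j U + A_j U)]_{aa}`, and each vector of averages moves by `i γ_a`. All averages can thus
be brought into a bounded fundamental domain of `Γ`, where the square of the derivative controls
the `W^{1,2}` norm. The direct method then applies: by Rellich's theorem a minimizing sequence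
converges almost everywhere along a subsequence, so that its limit is still unitary and the
averages converge, and the remaining quadratic term is weakly lower semicontinuous.
-/

noncomputable section

namespace BlochMV

open Filter Topology
open scoped FourierTransform Pointwise

/-! ### Weak convergence in `L²` -/

section L2

variable {X : Type*} [MeasurableSpace X] {μ : Measure X}

lemma integrable_norm_sq {E : Type*} [NormedAddCommGroup E] {f : X → E} (hf : MemLp f 2 μ) :
    Integrable (fun x => ‖f x‖ ^ 2) μ :=
  hf.integrable_norm_pow (by norm_num)

lemma integral_norm_add_sq_le {E : Type*} [NormedAddCommGroup E] {f g : X → E}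
    (hf : MemLp f 2 μ) (hg : MemLp g 2 μ) :
    ∫ x, ‖f x + g x‖ ^ 2 ∂μ ≤ 2 * (∫ x, ‖f x‖ ^ 2 ∂μ) + 2 * ∫ x, ‖g x‖ ^ 2 ∂μ := by
  have hf' := (integrable_norm_sq hf).const_mul 2
  have hg' := (integrable_norm_sq hg).const_mul 2
  rw [← integral_const_mul, ← integral_const_mul, ← integral_add hf' hg']
  refine integral_mono (integrable_norm_sq (hf.add hg)) (hf'.add hg') fun x => ?_
  have hadd : ‖f x + g x‖ ≤ ‖f x‖ + ‖g x‖ := norm_add_le _ _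
  calc ‖f x + g x‖ ^ 2 ≤ (‖f x‖ + ‖g x‖) ^ 2 := by gcongr
    _ ≤ 2 * ‖f x‖ ^ 2 + 2 * ‖g x‖ ^ 2 := by linarith [add_sq_le (a := ‖f x‖) (b := ‖g x‖)]

lemma norm_toLp_sq_eq_integral {E : Type*} [NormedAddCommGroup E] {f : X → E}
    (hf : MemLp f 2 μ) : ‖hf.toLp f‖ ^ 2 = ∫ x, ‖f x‖ ^ 2 ∂μ := by
  have hnonneg : 0 ≤ ∫ x, ‖f x‖ ^ 2 ∂μ := integral_nonneg fun x => by positivity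
  rw [Lp.norm_toLp, hf.eLpNorm_eq_integral_rpow_norm (by norm_num) (by norm_num),
    ENNReal.toReal_ofReal (by positivity)]
  simp [← Real.sqrt_eq_rpow, Real.sq_sqrt hnonneg, ← one_div]

variable {𝕜 : Type*} [RCLike 𝕜]

lemma norm_integral_mul_le {f g : X → 𝕜} (hf : MemLp f 2 μ) (hg : MemLp g 2 μ) :
    ‖∫ x, f x * g x ∂μ‖ ≤ √(∫ x, ‖f x‖ ^ 2 ∂μ) * √(∫ x, ‖g x‖ ^ 2 ∂μ) := by
  refine (norm_integral_le_integral_norm _).trans ?_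
  simp_rw [norm_mul]
  have h := integral_mul_norm_le_Lp_mul_Lq (μ := μ) Real.HolderConjugate.two_two
    (f := f) (g := g) (by simpa using hf) (by simpa using hg)
  simpa [Real.sqrt_eq_rpow] using h

lemma integral_mul_eq_inner {g v : X → 𝕜} (hg : MemLp g 2 μ) (hv : MemLp v 2 μ) :
    ∫ x, g x * v x ∂μ = ⟪hv.star.toLp (star v), hg.toLp g⟫_𝕜 := by
  rw [L2.inner_def]
  refine integral_congr_ae ?_
  filter_upwards [hg.coeFn_toLp, hv.star.coeFn_toLp] with x hgx hvx
  simp [hgx, hvx, RCLike.inner_apply]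

lemma memLp_mul_of_norm_le_one {p : ENNReal} {s f : X → 𝕜} (hs : AEStronglyMeasurable s μ)
    (hs1 : ∀ᵐ x ∂μ, ‖s x‖ ≤ 1) (hf : MemLp f p μ) : MemLp (fun x => s x * f x) p μ := by
  refine hf.of_le (hs.mul hf.1) (hs1.mono fun x hx => ?_)
  rw [norm_mul]
  exact mul_le_of_le_one_left (norm_nonneg _) hx

/-- Weak convergence `v n ⇀ w` in `L²(μ)`. It is stated for functions rather than for classes in
`Lp`, and with the bilinear pairing `∫ g v` instead of the inner product. -/
def WeaklyTendsto (μ : Measure X) (v : ℕ → X → 𝕜) (w : X → 𝕜) : Prop :=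
  ∀ g : X → 𝕜, MemLp g 2 μ →
    Tendsto (fun n => ∫ x, g x * v n x ∂μ) atTop (𝓝 (∫ x, g x * w x ∂μ))

lemma WeaklyTendsto.comp {v : ℕ → X → 𝕜} {w : X → 𝕜} (h : WeaklyTendsto μ v w)
    {φ : ℕ → ℕ} (hφ : Tendsto φ atTop atTop) : WeaklyTendsto μ (fun n => v (φ n)) w :=
  fun g hg => (h g hg).comp hφ

lemma WeaklyTendsto.congr {v v' : ℕ → X → 𝕜} {w w' : X → 𝕜} (h : WeaklyTendsto μ v w)
    (hv : ∀ n, v n =ᵐ[μ] v' n) (hw : w =ᵐ[μ] w') : WeaklyTendsto μ v' w' := by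
  intro g hg
  have hlim : ∫ x, g x * w x ∂μ = ∫ x, g x * w' x ∂μ :=
    integral_congr_ae (hw.mono fun x hx => congrArg (g x * ·) hx)
  rw [← hlim]
  exact (h g hg).congr fun n =>
    integral_congr_ae ((hv n).mono fun x hx => congrArg (g x * ·) hx)

lemma WeaklyTendsto.smul_measure {v : ℕ → X → 𝕜} {w : X → 𝕜} (h : WeaklyTendsto μ v w)
    {c : ENNReal} (hc₀ : c ≠ 0) (hc : c ≠ ⊤) : WeaklyTendsto (c • μ) v w := by
  intro g hg
  simp only [integral_smul_measure]
  have hg' := hg.smul_measure (ENNReal.inv_ne_top.2 hc₀)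
  rw [smul_smul, ENNReal.inv_mul_cancel hc₀ hc, one_smul] at hg'
  exact (h g hg').const_smul _

lemma exists_weaklyTendsto_subseq [IsSeparable μ] (v : ℕ → X → 𝕜)
    (hv : ∀ n, MemLp (v n) 2 μ) (C : ℝ) (hC : ∀ n, ∫ x, ‖v n x‖ ^ 2 ∂μ ≤ C) :
    ∃ φ : ℕ → ℕ, StrictMono φ ∧ ∃ w, MemLp w 2 μ ∧ WeaklyTendsto μ (fun n => v (φ n)) w := by
  have : Fact ((2 : ENNReal) ≠ ⊤) := ⟨by norm_num⟩
  let H := Lp 𝕜 2 μ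
  let functional (n : ℕ) : WeakDual 𝕜 H :=
    StrongDual.toWeakDual (InnerProductSpace.toDual 𝕜 H ((hv n).star.toLp (star (v n))))
  have hball (n : ℕ) :
      functional n ∈ WeakDual.toStrongDual ⁻¹' Metric.closedBall (0 : StrongDual 𝕜 H) (√C) := by
    have hnorm : ‖InnerProductSpace.toDual 𝕜 H ((hv n).star.toLp (star (v n)))‖ ≤ √C := by
      rw [LinearIsometryEquiv.norm_map]
      apply Real.le_sqrt_of_sq_le
      rw [norm_toLp_sq_eq_integral]
      simpa using hC n
    simpa [functional] using hnorm
  obtain ⟨a, -, φ, hφ, ha⟩ := WeakDual.isSeqCompact_closedBall 𝕜 H 0 (√C) hball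
  let w : H := (InnerProductSpace.toDual 𝕜 H).symm (WeakDual.toStrongDual a)
  refine ⟨φ, hφ, star w, (Lp.memLp w).star, fun g hg => ?_⟩
  have hlim : a (hg.toLp g) = ∫ x, g x * (star w : X → 𝕜) x ∂μ := by
    have hstar : (Lp.memLp w).star.star.toLp (star (star (w : X → 𝕜))) = w := by simp
    rw [integral_mul_eq_inner hg (Lp.memLp w).star, hstar, InnerProductSpace.toDual_symm_apply]
    rfl
  rw [← hlim]
  refine ((WeakDual.eval_continuous (hg.toLp g)).continuousAt.tendsto.comp ha).congr fun n => ?_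
  rw [integral_mul_eq_inner hg (hv (φ n))]
  rfl

lemma exists_weaklyTendsto_subseq_of_finite [IsSeparable μ] {ι : Type*} [Finite ι]
    (v : ι → ℕ → X → 𝕜) (hv : ∀ i n, MemLp (v i n) 2 μ) (C : ℝ)
    (hC : ∀ i n, ∫ x, ‖v i n x‖ ^ 2 ∂μ ≤ C) :
    ∃ φ : ℕ → ℕ, StrictMono φ ∧ ∃ w : ι → X → 𝕜, ∀ i, MemLp (w i) 2 μ ∧
      WeaklyTendsto μ (fun n => v i (φ n)) (w i) := by
  classical
  have := Fintype.ofFinite ι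
  suffices H : ∀ s : Finset ι, ∃ φ : ℕ → ℕ, StrictMono φ ∧ ∃ w : ι → X → 𝕜, ∀ i ∈ s,
      MemLp (w i) 2 μ ∧ WeaklyTendsto μ (fun n => v i (φ n)) (w i) by
    simpa using H Finset.univ
  intro s
  induction s using Finset.induction_on with
  | empty => exact ⟨id, strictMono_id, fun _ => 0, by simp⟩
  | insert i s hi ih =>
    obtain ⟨φ, hφ, w, hw⟩ := ih
    obtain ⟨ψ, hψ, w', hw'⟩ := exists_weaklyTendsto_subseq (fun n => v i (φ n))
      (fun n => hv i _) C (fun n => hC i _)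
    refine ⟨φ ∘ ψ, hφ.comp hψ, Function.update w i w', fun k hk => ?_⟩
    rcases eq_or_ne k i with rfl | hki
    · simpa using hw'
    · have hks : k ∈ s := Finset.mem_of_mem_insert_of_ne hk hki
      rw [Function.update_of_ne hki]
      exact ⟨(hw k hks).1, (hw k hks).2.comp hψ.tendsto_atTop⟩

lemma WeaklyTendsto.tendsto_integral_mul {v : ℕ → X → 𝕜} {w : X → 𝕜} (h : WeaklyTendsto μ v w)
    (hv : ∀ n, MemLp (v n) 2 μ) {C : ℝ} (hC : ∀ n, ∫ x, ‖v n x‖ ^ 2 ∂μ ≤ C)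
    {g : ℕ → X → 𝕜} {g' : X → 𝕜} (hg : ∀ n, MemLp (g n) 2 μ) (hg' : MemLp g' 2 μ)
    (hgg' : Tendsto (fun n => ∫ x, ‖g n x - g' x‖ ^ 2 ∂μ) atTop (𝓝 0)) :
    Tendsto (fun n => ∫ x, g n x * v n x ∂μ) atTop (𝓝 (∫ x, g' x * w x ∂μ)) := by
  have hdiff : Tendsto (fun n => ∫ x, (g n x - g' x) * v n x ∂μ) atTop (𝓝 0) := by
    refine squeeze_zero_norm (a := fun n => √(∫ x, ‖g n x - g' x‖ ^ 2 ∂μ) * √C)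
      (fun n => ?_) (by simpa using hgg'.sqrt.mul_const (√C))
    refine (norm_integral_mul_le ((hg n).sub hg') (hv n)).trans
      (mul_le_mul_of_nonneg_left (Real.sqrt_le_sqrt (hC n)) (Real.sqrt_nonneg _))
  have hsum := hdiff.add (h g' hg')
  rw [zero_add] at hsum
  refine hsum.congr fun n => ?_
  have hint : Integrable (fun x => (g n x - g' x) * v n x) μ :=
    ((hg n).sub hg').integrable_mul (hv n)
  have hint' : Integrable (fun x => g' x * v n x) μ := hg'.integrable_mul (hv n)
  rw [← integral_add hint hint']
  simp only [sub_mul, sub_add_cancel]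

lemma tendsto_integral_norm_sq_mul_sub {s : ℕ → X → 𝕜} {t f : X → 𝕜}
    (hs : ∀ n, AEStronglyMeasurable (s n) μ) (hs1 : ∀ n x, ‖s n x‖ ≤ 1)
    (hst : ∀ᵐ x ∂μ, Tendsto (fun n => s n x) atTop (𝓝 (t x))) (hf : MemLp f 2 μ) :
    Tendsto (fun n => ∫ x, ‖s n x * f x - t x * f x‖ ^ 2 ∂μ) atTop (𝓝 0) := by
  have ht : AEStronglyMeasurable t μ := aestronglyMeasurable_of_tendsto_ae _ hs hst
  have hlim := tendsto_integral_of_dominated_convergence (μ := μ)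
    (F := fun n x => ‖s n x * f x - t x * f x‖ ^ 2) (f := fun _ => (0 : ℝ))
    (fun x => 4 * ‖f x‖ ^ 2)
    (fun n => (((hs n).mul hf.1).sub (ht.mul hf.1)).norm.pow 2)
    ((integrable_norm_sq hf).const_mul 4)
    (fun n => hst.mono fun x hx => by
      have ht1 : ‖t x‖ ≤ 1 := le_of_tendsto hx.norm (Eventually.of_forall fun n => hs1 n x)
      have hle : ‖s n x * f x - t x * f x‖ ≤ 2 * ‖f x‖ := by
        rw [← sub_mul, norm_mul]
        gcongr
        linarith [norm_sub_le (s n x) (t x), hs1 n x]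
      rw [Real.norm_of_nonneg (by positivity)]
      calc ‖s n x * f x - t x * f x‖ ^ 2 ≤ (2 * ‖f x‖) ^ 2 := by gcongr
        _ = 4 * ‖f x‖ ^ 2 := by ring)
    (hst.mono fun x hx => by
      simpa using ((hx.mul_const (f x)).sub_const (t x * f x)).norm.pow 2)
  simpa using hlim

lemma WeaklyTendsto.tendsto_integral_mul_mul {v : ℕ → X → 𝕜} {w : X → 𝕜}
    (h : WeaklyTendsto μ v w) (hv : ∀ n, MemLp (v n) 2 μ) {C : ℝ}
    (hC : ∀ n, ∫ x, ‖v n x‖ ^ 2 ∂μ ≤ C)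
    {s : ℕ → X → 𝕜} {t f : X → 𝕜} (hs : ∀ n, AEStronglyMeasurable (s n) μ)
    (hs1 : ∀ n x, ‖s n x‖ ≤ 1) (hst : ∀ᵐ x ∂μ, Tendsto (fun n => s n x) atTop (𝓝 (t x)))
    (hf : MemLp f 2 μ) :
    Tendsto (fun n => ∫ x, s n x * f x * v n x ∂μ) atTop (𝓝 (∫ x, t x * f x * w x ∂μ)) := by
  have ht1 : ∀ᵐ x ∂μ, ‖t x‖ ≤ 1 := hst.mono fun x hx =>
    le_of_tendsto hx.norm (Eventually.of_forall fun n => hs1 n x)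
  exact h.tendsto_integral_mul hv hC
    (fun n => memLp_mul_of_norm_le_one (hs n) (Eventually.of_forall (hs1 n)) hf)
    (memLp_mul_of_norm_le_one (aestronglyMeasurable_of_tendsto_ae _ hs hst) ht1 hf)
    (tendsto_integral_norm_sq_mul_sub hs hs1 hst hf)

lemma two_mul_re_integral_sub_le {v w : X → 𝕜} (hv : MemLp v 2 μ) (hw : MemLp w 2 μ) :
    2 * RCLike.re (∫ x, star (w x) * v x ∂μ) - ∫ x, ‖w x‖ ^ 2 ∂μ ≤ ∫ x, ‖v x‖ ^ 2 ∂μ := by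
  have hint : Integrable (fun x => star (w x) * v x) μ := hw.star.integrable_mul hv
  rw [← integral_re hint, ← integral_const_mul,
    ← integral_sub (hint.re.const_mul 2) (integrable_norm_sq hw)]
  refine integral_mono ((hint.re.const_mul 2).sub (integrable_norm_sq hw))
    (integrable_norm_sq hv) fun x => ?_
  have hsq := @norm_sub_sq 𝕜 𝕜 _ _ _ (w x) (v x)
  rw [RCLike.inner_apply'] at hsq
  simp only [RCLike.star_def]
  nlinarith [sq_nonneg ‖w x - v x‖]

lemma WeaklyTendsto.exists_tendsto_le_integral_norm_sq {v : ℕ → X → 𝕜} {w : X → 𝕜}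
    (h : WeaklyTendsto μ v w) (hv : ∀ n, MemLp (v n) 2 μ) (hw : MemLp w 2 μ) :
    ∃ l : ℕ → ℝ, (∀ n, l n ≤ ∫ x, ‖v n x‖ ^ 2 ∂μ) ∧
      Tendsto l atTop (𝓝 (∫ x, ‖w x‖ ^ 2 ∂μ)) := by
  have hself : RCLike.re (∫ x, star (w x) * w x ∂μ) = ∫ x, ‖w x‖ ^ 2 ∂μ := by
    have hint : Integrable (fun x => star (w x) * w x) μ := hw.star.integrable_mul hw
    rw [← integral_re hint]
    refine integral_congr_ae (.of_forall fun x => ?_)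
    simp only [RCLike.star_def, RCLike.conj_mul, ← RCLike.ofReal_pow, RCLike.ofReal_re]
  have hlim : Tendsto (fun n => 2 * RCLike.re (∫ x, star (w x) * v n x ∂μ) - ∫ x, ‖w x‖ ^ 2 ∂μ)
      atTop (𝓝 (2 * RCLike.re (∫ x, star (w x) * w x ∂μ) - ∫ x, ‖w x‖ ^ 2 ∂μ)) :=
    (((RCLike.continuous_re.tendsto _).comp (h _ hw.star)).const_mul 2).sub_const _
  rw [hself, two_mul, add_sub_cancel_right] at hlim
  exact ⟨_, fun n => two_mul_re_integral_sub_le (hv n) hw, hlim⟩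

lemma WeaklyTendsto.integral_norm_sq_le {v : ℕ → X → 𝕜} {w : X → 𝕜} (h : WeaklyTendsto μ v w)
    (hv : ∀ n, MemLp (v n) 2 μ) (hw : MemLp w 2 μ) {C : ℝ}
    (hC : ∀ n, ∫ x, ‖v n x‖ ^ 2 ∂μ ≤ C) : ∫ x, ‖w x‖ ^ 2 ∂μ ≤ C := by
  obtain ⟨l, hle, hlim⟩ := h.exists_tendsto_le_integral_norm_sq hv hw
  exact le_of_tendsto hlim (.of_forall fun n => (hle n).trans (hC n))

lemma WeaklyTendsto.sub_const {v : ℕ → X → 𝕜} {w : X → 𝕜} (h : WeaklyTendsto μ v w)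
    (hv : ∀ n, MemLp (v n) 2 μ) (hw : MemLp w 2 μ) :
    WeaklyTendsto μ (fun n x => v n x - w x) (fun _ => 0) := by
  intro g hg
  have hv' (n : ℕ) : Integrable (fun x => g x * v n x) μ := hg.integrable_mul (hv n)
  have hw' : Integrable (fun x => g x * w x) μ := hg.integrable_mul hw
  simp only [mul_zero, integral_zero, mul_sub, integral_sub (hv' _) hw']
  rw [← sub_self (∫ x, g x * w x ∂μ)]
  exact (h g hg).sub_const _

lemma exists_seq_tendsto_ae_zero_of_integral {f : ℕ → X → ℝ} (hf : ∀ n, Integrable (f n) μ)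
    (hnonneg : ∀ n x, 0 ≤ f n x) (h : Tendsto (fun n => ∫ x, f n x ∂μ) atTop (𝓝 0)) :
    ∃ φ : ℕ → ℕ, StrictMono φ ∧ ∀ᵐ x ∂μ, Tendsto (fun n => f (φ n) x) atTop (𝓝 0) := by
  have heLp : Tendsto (fun n => eLpNorm (f n - 0) 1 μ) atTop (𝓝 0) := by
    rw [← ENNReal.ofReal_zero]
    refine (ENNReal.tendsto_ofReal h).congr fun n => ?_
    rw [sub_zero, eLpNorm_one_eq_lintegral_enorm,
      ofReal_integral_eq_lintegral_ofReal (hf n) (.of_forall (hnonneg n))]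
    exact lintegral_congr fun x => (Real.enorm_of_nonneg (hnonneg n x)).symm
  exact (tendstoInMeasure_of_tendsto_eLpNorm one_ne_zero (fun n => (hf n).1)
    aestronglyMeasurable_zero heLp).exists_seq_tendsto_ae

lemma exists_subseq_tendsto_ae_of_integral_norm_sq {E ι : Type*} [NormedAddCommGroup E]
    [Finite ι] {w : ι → ℕ → X → E} (hw : ∀ i n, MemLp (w i n) 2 μ)
    (h : ∀ i, Tendsto (fun n => ∫ x, ‖w i n x‖ ^ 2 ∂μ) atTop (𝓝 0)) :
    ∃ φ : ℕ → ℕ, StrictMono φ ∧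
      ∀ᵐ x ∂μ, ∀ i, Tendsto (fun n => w i (φ n) x) atTop (𝓝 0) := by
  have := Fintype.ofFinite ι
  have hsum : Tendsto (fun n => ∫ x, ∑ i, ‖w i n x‖ ^ 2 ∂μ) atTop (𝓝 0) := by
    have hlim := tendsto_finsetSum Finset.univ fun i _ => h i
    rw [Finset.sum_const_zero] at hlim
    refine hlim.congr fun n => ?_
    rw [integral_finsetSum _ fun i _ => integrable_norm_sq (hw i n)]
  obtain ⟨φ, hφ, hae⟩ := exists_seq_tendsto_ae_zero_of_integral
    (fun n => integrable_finsetSum _ fun i _ => integrable_norm_sq (hw i n))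
    (fun n x => Finset.sum_nonneg fun i _ => by positivity) hsum
  refine ⟨φ, hφ, hae.mono fun x hx i => ?_⟩
  have hsq : Tendsto (fun n => ‖w i (φ n) x‖ ^ 2) atTop (𝓝 0) :=
    squeeze_zero (fun n => by positivity)
      (fun n => Finset.single_le_sum (f := fun i => ‖w i (φ n) x‖ ^ 2)
        (fun i _ => by positivity) (Finset.mem_univ i)) hx
  rw [tendsto_zero_iff_norm_tendsto_zero]
  simpa only [Real.sqrt_sq (norm_nonneg _), Real.sqrt_zero] using hsq.sqrt

end L2

section Plancherel

variable {V F : Type*} [NormedAddCommGroup V] [InnerProductSpace ℝ V] [FiniteDimensional ℝ V]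
  [MeasurableSpace V] [BorelSpace V] [NormedAddCommGroup F] [InnerProductSpace ℂ F]
  [CompleteSpace F]

lemma integral_fourier_smul_eq {g : V → ℂ} (hg : Integrable g) {f : V → F} (hf : Integrable f) :
    ∫ ξ, 𝓕 g ξ • f ξ = ∫ x, g x • 𝓕 f x := by
  have := VectorFourier.integral_fourierIntegral_smul_eq_flip (L := innerₗ V)
    (e := Real.fourierChar) (μ := volume) (ν := volume) Real.continuous_fourierChar
    continuous_inner hg hf
  simpa [Real.fourier_eq, VectorFourier.fourierIntegral] using this

/- Both sides are paired with a test function: the left one through the Fourier transform of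
tempered distributions, the right one through self-adjointness of the Fourier integral. -/
lemma fourier_toLp_ae_eq {f : V → F} (hf : Integrable f) (hf2 : MemLp f 2) :
    (𝓕 (hf2.toLp f) : Lp (α := V) F 2) =ᵐ[volume] 𝓕 f := by
  have hcont : Continuous (𝓕 f) := VectorFourier.fourierIntegral_continuous
    Real.continuous_fourierChar (L := innerₗ V) continuous_inner hf
  refine ae_eq_of_integral_contDiff_smul_eq ((Lp.memLp _).locallyIntegrable (by norm_num))
    hcont.locallyIntegrable fun g hg hgc => ?_
  have hGc : HasCompactSupport (Complex.ofRealCLM ∘ g) := hgc.comp_left rfl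
  have hG : ContDiff ℝ ∞ (Complex.ofRealCLM ∘ g) := by fun_prop
  let G := hGc.toSchwartzMap hG
  have hGg (x : V) : G x = (g x : ℂ) := rfl
  have hpair := congrArg (fun T => T G) (Lp.fourier_toTemperedDistribution_eq (hf2.toLp f))
  simp only [TemperedDistribution.fourier_apply, Lp.toTemperedDistribution_apply] at hpair
  have hrepr : ∫ ξ, (𝓕 G) ξ • (hf2.toLp f) ξ = ∫ ξ, 𝓕 (G : V → ℂ) ξ • f ξ := by
    refine integral_congr_ae ?_
    filter_upwards [hf2.coeFn_toLp] with ξ hξ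
    rw [hξ, SchwartzMap.fourier_coe]
  rw [hrepr, integral_fourier_smul_eq G.integrable hf] at hpair
  simpa [hGg] using hpair.symm

lemma memLp_fourier {f : V → F} (hf : Integrable f) (hf2 : MemLp f 2) : MemLp (𝓕 f) 2 :=
  (memLp_congr_ae (fourier_toLp_ae_eq hf hf2)).1 (Lp.memLp _)

lemma integral_norm_fourier_sq {f : V → F} (hf : Integrable f) (hf2 : MemLp f 2) :
    ∫ ξ, ‖𝓕 f ξ‖ ^ 2 = ∫ x, ‖f x‖ ^ 2 := by
  rw [← norm_toLp_sq_eq_integral hf2, ← norm_toLp_sq_eq_integral (memLp_fourier hf hf2),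
    ← Lp.norm_fourier_eq (hf2.toLp f)]
  congr 2
  exact Lp.ext ((memLp_fourier hf hf2).coeFn_toLp.trans (fourier_toLp_ae_eq hf hf2).symm)

end Plancherel

/-! ### Weak derivatives -/

section L2loc

variable {d : ℕ} {F : Type*} [NormedAddCommGroup F]

lemma MemL2loc.congr {u v : Eu d → F} (hu : MemL2loc u) (h : u =ᵐ[volume] v) : MemL2loc v :=
  ⟨hu.1.congr h, fun K hK => (memLp_congr_ae (ae_restrict_of_ae h)).1 (hu.2 K hK)⟩

lemma isFiniteMeasure_restrict_of_isCompact {K : Set (Eu d)} (hK : IsCompact K) :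
    IsFiniteMeasure (volume.restrict K) :=
  isFiniteMeasure_restrict.2 hK.measure_ne_top

lemma MemL2loc.locallyIntegrable {u : Eu d → F} (hu : MemL2loc u) :
    LocallyIntegrable u volume := by
  rw [locallyIntegrable_iff]
  intro K hK
  have := isFiniteMeasure_restrict_of_isCompact hK
  exact (hu.2 K hK).integrable (by norm_num)

lemma MemL2loc.sub {u v : Eu d → F} (hu : MemL2loc u) (hv : MemL2loc v) :
    MemL2loc (fun x => u x - v x) :=
  ⟨hu.1.sub hv.1, fun K hK => (hu.2 K hK).sub (hv.2 K hK)⟩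

lemma MemL2loc.add {u v : Eu d → F} (hu : MemL2loc u) (hv : MemL2loc v) :
    MemL2loc (fun x => u x + v x) :=
  ⟨hu.1.add hv.1, fun K hK => (hu.2 K hK).add (hv.2 K hK)⟩

lemma memL2loc_of_continuous {u : Eu d → F} (hu : Continuous u) : MemL2loc u := by
  refine ⟨hu.aestronglyMeasurable, fun K hK => ?_⟩
  obtain ⟨C, hC⟩ := hK.exists_bound_of_continuousOn hu.continuousOn
  have := isFiniteMeasure_restrict_of_isCompact hK
  exact MemLp.of_bound hu.aestronglyMeasurable C
    ((ae_restrict_iff' hK.measurableSet).2 (Eventually.of_forall hC))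

lemma MemL2loc.continuous_smul [NormedSpace ℂ F] {u : Eu d → F} (hu : MemL2loc u)
    {g : Eu d → ℂ} (hg : Continuous g) : MemL2loc (fun x => g x • u x) := by
  refine ⟨hg.aestronglyMeasurable.smul hu.1, fun K hK => ?_⟩
  obtain ⟨C, hC⟩ := hK.exists_bound_of_continuousOn hg.continuousOn
  refine MemLp.of_le_mul (c := C) (hu.2 K hK)
    (hg.aestronglyMeasurable.smul (hu.2 K hK).1) ?_
  refine (ae_restrict_iff' hK.measurableSet).2 (Eventually.of_forall fun x hx => ?_)
  rw [norm_smul]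
  gcongr
  exact hC x hx

lemma MemL2loc.memLp_of_support_subset {u : Eu d → F} (hu : MemL2loc u) {K : Set (Eu d)}
    (hK : IsCompact K) (huK : Function.support u ⊆ K) : MemLp u 2 := by
  rw [← Set.indicator_eq_self.2 huK, memLp_indicator_iff_restrict hK.measurableSet]
  exact hu.2 K hK

lemma locallyIntegrable_comp_add_right {w : Eu d → F} (hw : LocallyIntegrable w volume)
    (l : Eu d) : LocallyIntegrable (fun x => w (x + l)) volume := by
  rw [locallyIntegrable_iff] at hw ⊢
  intro K hK
  have himage : IsCompact ((fun x => x + l) '' K) := hK.image (by fun_prop)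
  have hiff := (measurePreserving_add_right (volume : Measure (Eu d)) l).integrableOn_comp_preimage
    (measurableEmbedding_addRight l) (f := w) (s := (fun x => x + l) '' K)
  exact (hiff.2 (hw _ himage)).mono_set (Set.subset_preimage_image _ _)

end L2loc

section WeakDerivative

variable {d : ℕ} {F : Type*} [NormedAddCommGroup F] [NormedSpace ℝ F]

lemma HasWeakPartial.ae_eq [CompleteSpace F] {j : Fin d} {u v v' : Eu d → F}
    (h : HasWeakPartial j u v) (h' : HasWeakPartial j u v') : v =ᵐ[volume] v' :=
  ae_eq_of_integral_contDiff_smul_eq h.2.1 h'.2.1 fun φ hφ hc =>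
    neg_injective ((h.2.2 φ hφ hc).symm.trans (h'.2.2 φ hφ hc))

lemma HasWeakPartial.congr_left {j : Fin d} {u u' v : Eu d → F} (h : HasWeakPartial j u v)
    (huu' : u =ᵐ[volume] u') : HasWeakPartial j u' v := by
  refine ⟨(locallyIntegrable_congr huu').1 h.1, h.2.1, fun φ hφ hc => ?_⟩
  rw [← h.2.2 φ hφ hc]
  exact integral_congr_ae (huu'.mono fun x hx => by simp only [hx])

lemma HasWeakPartial.weakPartial {j : Fin d} {u v : Eu d → F}
    (h : HasWeakPartial j u v) : HasWeakPartial j u (weakPartial j u) := by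
  have hex : ∃ v, HasWeakPartial j u v := ⟨v, h⟩
  unfold BlochMV.weakPartial
  rw [dif_pos hex]
  exact hex.choose_spec

lemma HasWeakPartial.weakPartial_ae_eq [CompleteSpace F] {j : Fin d} {u v : Eu d → F}
    (h : HasWeakPartial j u v) : BlochMV.weakPartial j u =ᵐ[volume] v :=
  h.weakPartial.ae_eq h

lemma MemW12loc.hasWeakPartial {u : Eu d → F} (hu : MemW12loc u) (j : Fin d) :
    HasWeakPartial j u (BlochMV.weakPartial j u) :=
  (hu.2 j).choose_spec.2.weakPartial

lemma MemW12loc.memL2loc_weakPartial [CompleteSpace F] {u : Eu d → F} (hu : MemW12loc u)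
    (j : Fin d) : MemL2loc (weakPartial j u) := by
  obtain ⟨v, hv, h⟩ := hu.2 j
  exact hv.congr h.weakPartial_ae_eq.symm

lemma continuous_fderiv_apply_const {G : Type*} [NormedAddCommGroup G] [NormedSpace ℝ G]
    {φ : Eu d → G} (hφ : ContDiff ℝ ∞ φ) (e : Eu d) : Continuous fun x => fderiv ℝ φ x e :=
  (hφ.continuous_fderiv (by simp)).clm_apply continuous_const

lemma HasWeakPartial.sub {j : Fin d} {u v u' v' : Eu d → F}
    (h : HasWeakPartial j u v) (h' : HasWeakPartial j u' v') :
    HasWeakPartial j (fun x => u x - u' x) (fun x => v x - v' x) := by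
  refine ⟨h.1.sub h'.1, h.2.1.sub h'.2.1, fun φ hφ hc => ?_⟩
  have hdφ := continuous_fderiv_apply_const hφ (EuclideanSpace.single j 1)
  have hdc := hc.fderiv_apply (𝕜 := ℝ) (EuclideanSpace.single j 1)
  simp only [smul_sub]
  rw [integral_sub (h.1.integrable_smul_left_of_hasCompactSupport hdφ hdc)
    (h'.1.integrable_smul_left_of_hasCompactSupport hdφ hdc),
    integral_sub (h.2.1.integrable_smul_left_of_hasCompactSupport hφ.continuous hc)
    (h'.2.1.integrable_smul_left_of_hasCompactSupport hφ.continuous hc),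
    h.2.2 φ hφ hc, h'.2.2 φ hφ hc]
  abel

lemma HasWeakPartial.comp_add_right {j : Fin d} {u v : Eu d → F} (h : HasWeakPartial j u v)
    (l : Eu d) : HasWeakPartial j (fun x => u (x + l)) (fun x => v (x + l)) := by
  refine ⟨locallyIntegrable_comp_add_right h.1 l, locallyIntegrable_comp_add_right h.2.1 l,
    fun φ hφ hc => ?_⟩
  have htest := h.2.2 (fun x => φ (x - l)) (by fun_prop)
    (hc.comp_homeomorph (Homeomorph.subRight l))
  have hfderiv (x : Eu d) : fderiv ℝ (fun x => φ (x - l)) x = fderiv ℝ φ (x - l) :=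
    fderiv_comp_sub (f := φ) (x := x) l
  simp only [hfderiv] at htest
  rw [← integral_add_right_eq_self _ l,
    ← integral_add_right_eq_self (fun x => φ (x - l) • v x) l] at htest
  simpa using htest

section Complex

lemma fderiv_clm_comp_apply {G H : Type*} [NormedAddCommGroup G] [NormedSpace ℝ G]
    [NormedAddCommGroup H] [NormedSpace ℝ H] (L : G →L[ℝ] H) {φ : Eu d → G}
    (hφ : ContDiff ℝ ∞ φ) (x e : Eu d) :
    fderiv ℝ (fun y => L (φ y)) x e = L (fderiv ℝ φ x e) := by
  have h := L.hasFDerivAt.comp x (hφ.differentiable (by simp) x).hasFDerivAt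
  exact congrArg (fun T => T e) h.fderiv

variable [NormedSpace ℂ F] [IsScalarTower ℝ ℂ F]

lemma ofReal_smul (r : ℝ) (f : F) : (r : ℂ) • f = r • f :=
  algebraMap_smul ℂ r f

lemma complex_smul_eq_re_add_im (z : ℂ) (f : F) :
    z • f = z.re • f + Complex.I • (z.im • f) := by
  conv_lhs => rw [← Complex.re_add_im z]
  rw [add_smul, mul_comm, mul_smul, ofReal_smul, ofReal_smul]

lemma HasWeakPartial.integral_complex_smul {j : Fin d} {u v : Eu d → F}
    (h : HasWeakPartial j u v) {Φ : Eu d → ℂ} (hΦ : ContDiff ℝ ∞ Φ)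
    (hc : HasCompactSupport Φ) :
    ∫ x, fderiv ℝ Φ x (EuclideanSpace.single j 1) • u x = - ∫ x, Φ x • v x := by
  set e : Eu d := EuclideanSpace.single j 1
  have hre : ContDiff ℝ ∞ (fun x => (Φ x).re) := Complex.reCLM.contDiff.comp hΦ
  have him : ContDiff ℝ ∞ (fun x => (Φ x).im) := Complex.imCLM.contDiff.comp hΦ
  have hrec : HasCompactSupport (fun x => (Φ x).re) := hc.comp_left (g := Complex.re) rfl
  have himc : HasCompactSupport (fun x => (Φ x).im) := hc.comp_left (g := Complex.im) rfl
  have hdre (x : Eu d) : (fderiv ℝ Φ x e).re = fderiv ℝ (fun x => (Φ x).re) x e :=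
    (fderiv_clm_comp_apply Complex.reCLM hΦ x e).symm
  have hdim (x : Eu d) : (fderiv ℝ Φ x e).im = fderiv ℝ (fun x => (Φ x).im) x e :=
    (fderiv_clm_comp_apply Complex.imCLM hΦ x e).symm
  have hre_test := h.2.2 _ hre hrec
  have him_test := h.2.2 _ him himc
  simp only [complex_smul_eq_re_add_im (fderiv ℝ Φ _ e), complex_smul_eq_re_add_im (Φ _),
    hdre, hdim]
  have hdre_int := h.1.integrable_smul_left_of_hasCompactSupport
    (continuous_fderiv_apply_const hre e) (hrec.fderiv_apply (𝕜 := ℝ) e)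
  have hdim_int := h.1.integrable_smul_left_of_hasCompactSupport
    (continuous_fderiv_apply_const him e) (himc.fderiv_apply (𝕜 := ℝ) e)
  have hre_int := h.2.1.integrable_smul_left_of_hasCompactSupport hre.continuous hrec
  have him_int := h.2.1.integrable_smul_left_of_hasCompactSupport him.continuous himc
  rw [integral_add hdre_int (hdim_int.fun_smul Complex.I),
    integral_add hre_int (him_int.fun_smul Complex.I), integral_smul, integral_smul, hre_test,
    him_test, smul_neg, ← neg_add]

lemma HasWeakPartial.smooth_smul {j : Fin d} {u v : Eu d → F} (h : HasWeakPartial j u v)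
    {g : Eu d → ℂ} (hg : ContDiff ℝ ∞ g) :
    HasWeakPartial j (fun x => g x • u x)
      (fun x => fderiv ℝ g x (EuclideanSpace.single j 1) • u x + g x • v x) := by
  set e : Eu d := EuclideanSpace.single j 1
  have hgu := h.1.continuous_smul hg.continuous
  have hdgu := h.1.continuous_smul (continuous_fderiv_apply_const hg e)
  have hgv := h.2.1.continuous_smul hg.continuous
  refine ⟨hgu, hdgu.add hgv, fun φ hφ hc => ?_⟩
  have hφ' : ContDiff ℝ ∞ (fun x => (φ x : ℂ)) := Complex.ofRealCLM.contDiff.comp hφ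
  have hc' : HasCompactSupport (fun x => (φ x : ℂ)) := hc.comp_left Complex.ofReal_zero
  have htest := h.integral_complex_smul (hφ'.mul hg) hc'.mul_right
  have hderiv (x : Eu d) : fderiv ℝ ((fun x => (φ x : ℂ)) * g) x e • u x
      = fderiv ℝ φ x e • (g x • u x) + φ x • (fderiv ℝ g x e • u x) := by
    have hdφ : fderiv ℝ (fun x => (φ x : ℂ)) x e = (fderiv ℝ φ x e : ℝ) :=
      fderiv_clm_comp_apply Complex.ofRealCLM hφ x e
    rw [fderiv_mul (hφ'.differentiable (by simp) x) (hg.differentiable (by simp) x)]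
    simp only [add_apply, smul_apply, smul_eq_mul]
    rw [hdφ, add_comm, add_smul, mul_comm (g x), mul_smul, mul_smul, ofReal_smul, ofReal_smul]
  change ∫ x, fderiv ℝ ((fun x => (φ x : ℂ)) * g) x e • u x = -∫ x, ((φ x : ℂ) * g x) • v x
    at htest
  simp only [hderiv, mul_smul, ofReal_smul] at htest
  rw [integral_add (hgu.integrable_smul_left_of_hasCompactSupport
      (continuous_fderiv_apply_const hφ e) (hc.fderiv_apply (𝕜 := ℝ) e))
    (hdgu.integrable_smul_left_of_hasCompactSupport hφ.continuous hc)] at htest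
  simp only [smul_add]
  rw [integral_add (hdgu.integrable_smul_left_of_hasCompactSupport hφ.continuous hc)
    (hgv.integrable_smul_left_of_hasCompactSupport hφ.continuous hc), neg_add, ← htest]
  abel

end Complex

end WeakDerivative

/-! ### Compactness by the Fourier transform -/

section Rellich

section CompactEmbedding

variable {V F : Type*} [NormedAddCommGroup V] [InnerProductSpace ℝ V] [FiniteDimensional ℝ V]
  [MeasurableSpace V] [BorelSpace V] [NormedAddCommGroup F]

lemma integrable_of_support_subset {f : V → F} {K : Set V} (hK : IsCompact K)
    (hf2 : MemLp f 2) (hfK : Function.support f ⊆ K) : Integrable f := by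
  rw [← Set.indicator_eq_self.2 hfK, integrable_indicator_iff hK.measurableSet]
  have : IsFiniteMeasure (volume.restrict K) := isFiniteMeasure_restrict.2 hK.measure_ne_top
  exact (hf2.restrict K).integrable (by norm_num)

lemma integral_norm_le_of_support_subset {f : V → F} {K : Set V} (hK : IsCompact K)
    (hf2 : MemLp f 2) (hfK : Function.support f ⊆ K) :
    ∫ x, ‖f x‖ ≤ volume.real K + ∫ x, ‖f x‖ ^ 2 := by
  have hsq := integrable_norm_sq hf2
  have : IsFiniteMeasure (volume.restrict K) := isFiniteMeasure_restrict.2 hK.measure_ne_top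
  have hsupp : Function.support (fun x => ‖f x‖) ⊆ K := by simpa [Function.support] using hfK
  calc ∫ x, ‖f x‖
      = ∫ x in K, ‖f x‖ := (setIntegral_eq_integral_of_forall_compl_eq_zero
        fun x hx => Function.notMem_support.1 fun h => hx (hsupp h)).symm
    _ ≤ ∫ x in K, (1 + ‖f x‖ ^ 2) := by
        refine integral_mono ((hf2.restrict K).integrable (by norm_num)).norm
          ((integrable_const 1).add hsq.restrict) fun x => ?_
        nlinarith [sq_nonneg (‖f x‖ - 1), sq_nonneg (‖f x‖)]
    _ = volume.real K + ∫ x in K, ‖f x‖ ^ 2 := by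
        rw [integral_add (integrable_const 1) hsq.restrict]
        simp
    _ ≤ volume.real K + ∫ x, ‖f x‖ ^ 2 := by
        gcongr
        · exact Eventually.of_forall fun x => by positivity
        · exact Measure.restrict_le_self

lemma tendsto_setIntegral_norm_sq_of_bounded {h : ℕ → V → F} {B : ℝ}
    (hmeas : ∀ n, AEStronglyMeasurable (h n)) (hB : ∀ n ξ, ‖h n ξ‖ ≤ B)
    (hlim : ∀ ξ, Tendsto (fun n => h n ξ) atTop (𝓝 0)) {K : Set V} (hK : IsCompact K) :
    Tendsto (fun n => ∫ ξ in K, ‖h n ξ‖ ^ 2) atTop (𝓝 0) := by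
  have : IsFiniteMeasure (volume.restrict K) := isFiniteMeasure_restrict.2 hK.measure_ne_top
  rw [← integral_zero V ℝ]
  refine tendsto_integral_of_dominated_convergence (fun _ => B ^ 2)
    (fun n => ((hmeas n).norm.pow 2).restrict) (integrable_const _)
    (fun n => Eventually.of_forall fun ξ => ?_)
    (Eventually.of_forall fun ξ => by simpa using (hlim ξ).norm.pow 2)
  rw [Real.norm_of_nonneg (by positivity)]
  gcongr
  exact hB n ξ

lemma setIntegral_compl_closedBall_norm_sq_le {h : V → F} (hh : MemLp h 2) {D R : ℝ} (hR : 0 < R)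
    (hint : Integrable fun ξ => ‖ξ‖ ^ 2 * ‖h ξ‖ ^ 2) (hD : ∫ ξ, ‖ξ‖ ^ 2 * ‖h ξ‖ ^ 2 ≤ D) :
    ∫ ξ in (Metric.closedBall (0 : V) R)ᶜ, ‖h ξ‖ ^ 2 ≤ D / R ^ 2 :=
  calc ∫ ξ in (Metric.closedBall (0 : V) R)ᶜ, ‖h ξ‖ ^ 2
      ≤ ∫ ξ in (Metric.closedBall (0 : V) R)ᶜ, ‖ξ‖ ^ 2 * ‖h ξ‖ ^ 2 / R ^ 2 := by
        refine setIntegral_mono_on (integrable_norm_sq hh).integrableOn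
          (hint.div_const _).integrableOn measurableSet_closedBall.compl fun ξ hξ => ?_
        have hξR : R < ‖ξ‖ := by simpa using hξ
        rw [le_div_iff₀ (by positivity), mul_comm]
        gcongr
    _ ≤ ∫ ξ, ‖ξ‖ ^ 2 * ‖h ξ‖ ^ 2 / R ^ 2 := setIntegral_le_integral (hint.div_const _)
        (Eventually.of_forall fun ξ => by positivity)
    _ ≤ D / R ^ 2 := by
        rw [integral_div]
        gcongr

lemma tendsto_integral_norm_sq_of_tight {h : ℕ → V → F} {B D : ℝ}
    (hh : ∀ n, MemLp (h n) 2) (hB : ∀ n ξ, ‖h n ξ‖ ≤ B)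
    (hint : ∀ n, Integrable fun ξ => ‖ξ‖ ^ 2 * ‖h n ξ‖ ^ 2)
    (hD : ∀ n, ∫ ξ, ‖ξ‖ ^ 2 * ‖h n ξ‖ ^ 2 ≤ D)
    (hlim : ∀ ξ, Tendsto (fun n => h n ξ) atTop (𝓝 0)) :
    Tendsto (fun n => ∫ ξ, ‖h n ξ‖ ^ 2) atTop (𝓝 0) := by
  rw [Metric.tendsto_atTop]
  intro ε hε
  have htail : Tendsto (fun R : ℝ => D / R ^ 2) atTop (𝓝 0) :=
    tendsto_const_nhds.div_atTop (tendsto_pow_atTop (by norm_num))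
  obtain ⟨R, hRD, hR⟩ :=
    ((htail.eventually_lt_const (half_pos hε)).and (eventually_gt_atTop 0)).exists
  obtain ⟨N, hN⟩ := eventually_atTop.1 <|
    (tendsto_setIntegral_norm_sq_of_bounded (fun n => (hh n).1) hB hlim
      (isCompact_closedBall 0 R)).eventually_lt_const (half_pos hε)
  refine ⟨N, fun n hn => ?_⟩
  rw [Real.dist_0_eq_abs, abs_of_nonneg (integral_nonneg fun ξ => by positivity),
    ← integral_add_compl measurableSet_closedBall (integrable_norm_sq (hh n))]
  linarith [hN n hn, setIntegral_compl_closedBall_norm_sq_le (hh n) hR (hint n) (hD n)]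

variable [InnerProductSpace ℂ F]

lemma norm_fourier_le_integral_norm (f : V → F) (ξ : V) : ‖𝓕 f ξ‖ ≤ ∫ x, ‖f x‖ := by
  rw [Real.fourier_eq]
  exact (norm_integral_le_integral_norm _).trans_eq (by simp only [Circle.norm_smul])

/- Compact supports turn the `L²` bound into a uniform bound on the Fourier transforms, which
converge to zero pointwise and, by the moment bound, lose no mass at infinity. -/
lemma tendsto_integral_norm_sq_of_fourier [CompleteSpace F] {f : ℕ → V → F} {K : Set V}
    {C D : ℝ} (hK : IsCompact K) (hfK : ∀ n, Function.support (f n) ⊆ K)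
    (hf : ∀ n, MemLp (f n) 2) (hC : ∀ n, ∫ x, ‖f n x‖ ^ 2 ≤ C)
    (hint : ∀ n, Integrable fun ξ => ‖ξ‖ ^ 2 * ‖𝓕 (f n) ξ‖ ^ 2)
    (hD : ∀ n, ∫ ξ, ‖ξ‖ ^ 2 * ‖𝓕 (f n) ξ‖ ^ 2 ≤ D)
    (hlim : ∀ ξ, Tendsto (fun n => 𝓕 (f n) ξ) atTop (𝓝 0)) :
    Tendsto (fun n => ∫ x, ‖f n x‖ ^ 2) atTop (𝓝 0) := by
  have hf1 (n : ℕ) : Integrable (f n) := integrable_of_support_subset hK (hf n) (hfK n)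
  simp only [← integral_norm_fourier_sq (hf1 _) (hf _)]
  refine tendsto_integral_norm_sq_of_tight (B := volume.real K + C)
    (fun n => memLp_fourier (hf1 n) (hf n)) (fun n ξ => ?_) hint hD hlim
  exact (norm_fourier_le_integral_norm _ ξ).trans
    ((integral_norm_le_of_support_subset hK (hf n) (hfK n)).trans (by gcongr; exact hC n))

end CompactEmbedding

variable {d : ℕ} {F : Type*} [NormedAddCommGroup F] [InnerProductSpace ℂ F]

lemma contDiff_fourierChar_neg_inner (ξ : Eu d) :
    ContDiff ℝ ∞ fun x : Eu d => (Real.fourierChar (-⟪x, ξ⟫_ℝ) : ℂ) := by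
  simp only [Real.fourierChar_apply]
  have hphase : ContDiff ℝ ∞ fun x : Eu d => 2 * Real.pi * -⟪x, ξ⟫_ℝ :=
    contDiff_const.mul (contDiff_id.inner ℝ contDiff_const).neg
  exact ((Complex.ofRealCLM.contDiff.comp hphase).mul contDiff_const).cexp

lemma fderiv_fourierChar_neg_inner (ξ x : Eu d) (j : Fin d) :
    fderiv ℝ (fun x : Eu d => (Real.fourierChar (-⟪x, ξ⟫_ℝ) : ℂ)) x (EuclideanSpace.single j 1)
      = -(2 * Real.pi * Complex.I * ξ j) * Real.fourierChar (-⟪x, ξ⟫_ℝ) := by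
  refine (Real.fderiv_fourierChar_neg_bilinear_left_apply (innerSL ℝ) x
    (EuclideanSpace.single j 1) ξ).trans ?_
  have hξ : innerSL ℝ (EuclideanSpace.single j 1) ξ = ξ j := by
    simp [EuclideanSpace.inner_single_left]
  rw [hξ]
  ring_nf
  rfl

lemma HasWeakPartial.integral_smul_of_fderiv_eq {j : Fin d} {u v : Eu d → F}
    (h : HasWeakPartial j u v) {η E : Eu d → ℂ} (hη : ContDiff ℝ ∞ η) (hc : HasCompactSupport η)
    (hE : ContDiff ℝ ∞ E) {c : ℂ}
    (hEc : ∀ x, fderiv ℝ E x (EuclideanSpace.single j 1) = -c * E x) :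
    ∫ x, E x • (fderiv ℝ η x (EuclideanSpace.single j 1) • u x + η x • v x)
      = c • ∫ x, E x • η x • u x := by
  have hu := h.1.continuous_smul hE.continuous
  have hu_int := hu.integrable_smul_left_of_hasCompactSupport hη.continuous hc
  have hv_int := (h.2.1.continuous_smul
    hE.continuous).integrable_smul_left_of_hasCompactSupport hη.continuous hc
  have hdη_int := hu.integrable_smul_left_of_hasCompactSupport
    (continuous_fderiv_apply_const hη (EuclideanSpace.single j 1)) (hc.fderiv_apply (𝕜 := ℝ) _)
  have htest := (h.smooth_smul hE).integral_complex_smul hη hc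
  simp only [hEc, mul_smul, smul_add, smul_comm (η _) (-c)] at htest
  rw [integral_add (hu_int.fun_smul _) hv_int, integral_smul] at htest
  simp only [smul_add, smul_comm (E _)]
  rw [integral_add hdη_int hv_int, htest, neg_smul]
  abel

lemma HasWeakPartial.fourier_smooth_smul {j : Fin d} {u v : Eu d → F} (h : HasWeakPartial j u v)
    {η : Eu d → ℂ} (hη : ContDiff ℝ ∞ η) (hc : HasCompactSupport η) (ξ : Eu d) :
    𝓕 (fun x => fderiv ℝ η x (EuclideanSpace.single j 1) • u x + η x • v x) ξ
      = (2 * Real.pi * Complex.I * ξ j : ℂ) • 𝓕 (fun x => η x • u x) ξ := by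
  rw [Real.fourier_eq, Real.fourier_eq]
  exact h.integral_smul_of_fderiv_eq hη hc (contDiff_fourierChar_neg_inner ξ)
    fun x => fderiv_fourierChar_neg_inner ξ x j

lemma norm_sq_mul_norm_fourier_sq_le {f : Eu d → F} {g : Fin d → Eu d → F} {ξ : Eu d}
    (h : ∀ j, 𝓕 (g j) ξ = (2 * Real.pi * Complex.I * ξ j : ℂ) • 𝓕 f ξ) :
    ‖ξ‖ ^ 2 * ‖𝓕 f ξ‖ ^ 2 ≤ ∑ j, ‖𝓕 (g j) ξ‖ ^ 2 := by
  rw [EuclideanSpace.norm_sq_eq, Finset.sum_mul]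
  refine Finset.sum_le_sum fun j _ => ?_
  have hnorm : ‖(2 * Real.pi * Complex.I * ξ j : ℂ)‖ = 2 * Real.pi * ‖ξ j‖ := by
    simp [abs_of_pos Real.pi_pos]
  rw [h j, norm_smul, hnorm, ← mul_pow]
  gcongr
  exact le_mul_of_one_le_left (norm_nonneg _) (by linarith [Real.pi_gt_three])

lemma integral_norm_sq_mul_norm_fourier_sq_le [CompleteSpace F] {f : Eu d → F}
    {g : Fin d → Eu d → F} (hf : Integrable f) (hf2 : MemLp f 2)
    (hg : ∀ j, Integrable (g j)) (hg2 : ∀ j, MemLp (g j) 2)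
    (h : ∀ j ξ, 𝓕 (g j) ξ = (2 * Real.pi * Complex.I * ξ j : ℂ) • 𝓕 f ξ) :
    Integrable (fun ξ => ‖ξ‖ ^ 2 * ‖𝓕 f ξ‖ ^ 2) ∧
      ∫ ξ, ‖ξ‖ ^ 2 * ‖𝓕 f ξ‖ ^ 2 ≤ ∑ j, ∫ x, ‖g j x‖ ^ 2 := by
  have hsq (j : Fin d) : Integrable fun ξ => ‖𝓕 (g j) ξ‖ ^ 2 :=
    integrable_norm_sq (memLp_fourier (hg j) (hg2 j))
  have hle (ξ : Eu d) : ‖ξ‖ ^ 2 * ‖𝓕 f ξ‖ ^ 2 ≤ ∑ j, ‖𝓕 (g j) ξ‖ ^ 2 :=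
    norm_sq_mul_norm_fourier_sq_le fun j => h j ξ
  have hint : Integrable (fun ξ => ‖ξ‖ ^ 2 * ‖𝓕 f ξ‖ ^ 2) := by
    refine (integrable_finsetSum Finset.univ fun j _ => hsq j).mono'
      ((continuous_norm.pow 2).aestronglyMeasurable.mul
        ((memLp_fourier hf hf2).1.norm.pow 2)) (Eventually.of_forall fun ξ => ?_)
    rw [Real.norm_of_nonneg (by positivity)]
    exact hle ξ
  refine ⟨hint, ?_⟩
  calc ∫ ξ, ‖ξ‖ ^ 2 * ‖𝓕 f ξ‖ ^ 2
      ≤ ∫ ξ, ∑ j, ‖𝓕 (g j) ξ‖ ^ 2 :=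
        integral_mono hint (integrable_finsetSum _ fun j _ => hsq j) hle
    _ = ∑ j, ∫ x, ‖g j x‖ ^ 2 := by
        rw [integral_finsetSum _ fun j _ => hsq j]
        simp only [integral_norm_fourier_sq (hg _) (hg2 _)]

lemma MemL2loc.memLp_smul {ψ : Eu d → ℂ} {u : Eu d → F} (hu : MemL2loc u) (hψ : Continuous ψ)
    {K : Set (Eu d)} (hK : IsCompact K) (hψK : Function.support ψ ⊆ K) :
    MemLp (fun x => ψ x • u x) 2 :=
  (hu.continuous_smul hψ).memLp_of_support_subset hK
    ((Function.support_smul_subset_left _ _).trans hψK)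

lemma MemL2loc.integrable_smul {ψ : Eu d → ℂ} {u : Eu d → F} (hu : MemL2loc u)
    (hψ : Continuous ψ) {K : Set (Eu d)} (hK : IsCompact K) (hψK : Function.support ψ ⊆ K) :
    Integrable (fun x => ψ x • u x) :=
  integrable_of_support_subset hK (hu.memLp_smul hψ hK hψK)
    ((Function.support_smul_subset_left _ _).trans hψK)

lemma integral_norm_smul_sq_le {ψ : Eu d → ℂ} {u : Eu d → F} (hu : MemL2loc u)
    {K : Set (Eu d)} (hK : IsCompact K) (hψK : Function.support ψ ⊆ K) {M : ℝ}
    (hM : ∀ x, ‖ψ x‖ ≤ M) : ∫ x, ‖ψ x • u x‖ ^ 2 ≤ M ^ 2 * ∫ x in K, ‖u x‖ ^ 2 := by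
  have hzero (x : Eu d) (hx : x ∉ K) : ‖ψ x • u x‖ ^ 2 = 0 := by
    simp [Function.notMem_support.1 fun h => hx (hψK h)]
  rw [← setIntegral_eq_integral_of_forall_compl_eq_zero hzero, ← integral_const_mul]
  refine integral_mono_of_nonneg (Eventually.of_forall fun x => by positivity)
    ((integrable_norm_sq (hu.2 K hK)).const_mul _) (Eventually.of_forall fun x => ?_)
  dsimp only
  rw [norm_smul, mul_pow]
  gcongr
  exact hM x

/- A local Rellich–Kondrashov theorem: the Fourier transforms of `η • w n` converge to zero
pointwise by weak convergence, and the derivatives control their second moments. -/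
theorem tendsto_integral_smooth_smul_of_weak [CompleteSpace F] {η : Eu d → ℂ}
    (hη : ContDiff ℝ ∞ η) (hc : HasCompactSupport η) {w : ℕ → Eu d → F}
    {v : Fin d → ℕ → Eu d → F} (hw : ∀ n, MemL2loc (w n)) (hv : ∀ j n, MemL2loc (v j n))
    (hwv : ∀ j n, HasWeakPartial j (w n) (v j n)) {C : ℝ}
    (hCw : ∀ n, ∫ x in tsupport η, ‖w n x‖ ^ 2 ≤ C)
    (hCv : ∀ j n, ∫ x in tsupport η, ‖v j n x‖ ^ 2 ≤ C)
    (hweak : ∀ φ : Eu d → ℂ, Continuous φ → HasCompactSupport φ →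
      Tendsto (fun n => ∫ x, φ x • w n x) atTop (𝓝 0)) :
    Tendsto (fun n => ∫ x, ‖η x • w n x‖ ^ 2) atTop (𝓝 0) := by
  let e (j : Fin d) : Eu d := EuclideanSpace.single j 1
  let f (n : ℕ) (x : Eu d) : F := η x • w n x
  let g (j : Fin d) (n : ℕ) (x : Eu d) : F := fderiv ℝ η x (e j) • w n x + η x • v j n x
  have hdη (j : Fin d) := continuous_fderiv_apply_const hη (e j)
  have hη_supp : Function.support η ⊆ tsupport η := subset_tsupport η
  have hdη_supp (j : Fin d) : (Function.support fun x => fderiv ℝ η x (e j)) ⊆ tsupport η :=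
    (subset_tsupport _).trans (tsupport_fderiv_apply_subset ℝ (e j))
  have hf (n : ℕ) : MemLp (f n) 2 := (hw n).memLp_smul hη.continuous hc hη_supp
  have hf1 (n : ℕ) : Integrable (f n) := (hw n).integrable_smul hη.continuous hc hη_supp
  have hdηw (j : Fin d) (n : ℕ) := (hw n).memLp_smul (hdη j) hc (hdη_supp j)
  have hηv (j : Fin d) (n : ℕ) := (hv j n).memLp_smul hη.continuous hc hη_supp
  have hg (j : Fin d) (n : ℕ) : MemLp (g j n) 2 := (hdηw j n).add (hηv j n)
  have hg1 (j : Fin d) (n : ℕ) : Integrable (g j n) :=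
    ((hw n).integrable_smul (hdη j) hc (hdη_supp j)).add
      ((hv j n).integrable_smul hη.continuous hc hη_supp)
  obtain ⟨M, hM⟩ := hc.exists_bound_of_continuous hη.continuous
  choose M' hM' using fun j =>
    (hc.fderiv_apply (𝕜 := ℝ) (e j)).exists_bound_of_continuous (hdη j)
  have hfC (n : ℕ) : ∫ x, ‖f n x‖ ^ 2 ≤ M ^ 2 * C :=
    (integral_norm_smul_sq_le (hw n) hc hη_supp hM).trans (by gcongr; exact hCw n)
  have hgC (j : Fin d) (n : ℕ) :
      ∫ x, ‖g j n x‖ ^ 2 ≤ 2 * (M' j ^ 2 * C) + 2 * (M ^ 2 * C) := by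
    refine (integral_norm_add_sq_le (hdηw j n) (hηv j n)).trans ?_
    gcongr
    · exact (integral_norm_smul_sq_le (hw n) hc (hdη_supp j) (hM' j)).trans
        (by gcongr; exact hCw n)
    · exact (integral_norm_smul_sq_le (hv j n) hc hη_supp hM).trans (by gcongr; exact hCv j n)
  have hmoment (n : ℕ) := integral_norm_sq_mul_norm_fourier_sq_le (hf1 n) (hf n)
    (fun j => hg1 j n) (fun j => hg j n) fun j ξ => (hwv j n).fourier_smooth_smul hη hc ξ
  refine tendsto_integral_norm_sq_of_fourier hc
    (fun n => (Function.support_smul_subset_left _ _).trans hη_supp) hf hfC (fun n => (hmoment n).1)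
    (fun n => (hmoment n).2.trans (Finset.sum_le_sum fun j _ => hgC j n)) fun ξ => ?_
  refine (hweak _ ((contDiff_fourierChar_neg_inner ξ).continuous.mul hη.continuous)
    hc.mul_left).congr fun n => ?_
  rw [Real.fourier_eq]
  exact integral_congr_ae (Eventually.of_forall fun x => mul_smul _ _ _)

end Rellich

/-! ### The dual lattice and periodic functions -/

section DualLattice

variable {d : ℕ} (b : Module.Basis (Fin d) ℝ (Eu d))

/-- The pairing `(k, x) ↦ (k · x) / 2π`; the dual lattice is the dual of `Γ` for it. -/
def dualPairing (d : ℕ) : LinearMap.BilinForm ℝ (Eu d) := (2 * Real.pi)⁻¹ • innerₗ (Eu d)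

lemma dualPairing_apply (k x : Eu d) : dualPairing d k x = (2 * Real.pi)⁻¹ * ⟪k, x⟫_ℝ := rfl

lemma dualPairing_nondegenerate : (dualPairing d).Nondegenerate := by
  have hpi : (2 * Real.pi)⁻¹ ≠ 0 := by positivity
  refine ⟨fun x hx => ?_, fun x hx => ?_⟩ <;>
  · have h := hx x
    rw [dualPairing_apply] at h
    exact inner_self_eq_zero.1 ((mul_eq_zero.1 h).resolve_left hpi)

/-- The generators `γ*_i` of the dual lattice, `γ*_i · γ_j = 2π δ_{ij}`. -/
def dualBasis : Module.Basis (Fin d) ℝ (Eu d) :=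
  (dualPairing d).dualBasis dualPairing_nondegenerate b

lemma dualBasis_repr_apply (k : Eu d) (j : Fin d) :
    (dualBasis b).repr k j = (2 * Real.pi)⁻¹ * ⟪k, b j⟫_ℝ :=
  LinearMap.BilinForm.dualBasis_repr_apply ..

lemma mem_dualLattice_iff {k : Eu d} :
    k ∈ dualLattice b ↔ k ∈ Submodule.span ℤ (Set.range (dualBasis b)) := by
  have hpi : 2 * Real.pi ≠ 0 := by positivity
  rw [dualBasis, ← LinearMap.BilinForm.dualSubmodule_span_of_basis,
    LinearMap.BilinForm.mem_dualSubmodule]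
  refine forall₂_congr fun γ _ => ?_
  rw [dualPairing_apply, Submodule.mem_one]
  refine exists_congr fun n => ?_
  rw [eq_inv_mul_iff_mul_eq₀ hpi, eq_comm, eq_intCast]

lemma dualLattice_eq :
    dualLattice b = (Submodule.span ℤ (Set.range (dualBasis b))).toAddSubgroup :=
  AddSubgroup.ext fun _ => mem_dualLattice_iff b

instance : Countable (dualLattice b) := by
  rw [dualLattice_eq]
  exact inferInstanceAs (Countable (Submodule.span ℤ (Set.range (dualBasis b))))

/-- The centre `(γ*_1 + ⋯ + γ*_d) / 2` of the parallelepiped spanned by the dual basis. -/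
def dualCenter : Eu d := ∑ i, (2⁻¹ : ℝ) • dualBasis b i

lemma dualBasis_repr_dualCenter (j : Fin d) : (dualBasis b).repr (dualCenter b) j = 2⁻¹ := by
  rw [dualCenter, Module.Basis.repr_sum_self]

lemma mem_dualCell_iff {k : Eu d} :
    k ∈ dualCell b ↔ dualCenter b + k ∈ parallelepiped (dualBasis b) := by
  rw [parallelepiped_basis_eq]
  refine forall_congr' fun j => ?_
  rw [map_add, Finsupp.add_apply, dualBasis_repr_dualCenter, dualBasis_repr_apply,
    inv_mul_eq_div, Set.mem_Icc, Set.mem_Icc, ← neg_le_iff_add_nonneg', ← le_sub_iff_add_le',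
    le_div_iff₀ (by positivity), div_le_iff₀ (by positivity)]
  constructor <;> rintro ⟨h₁, h₂⟩ <;> constructor <;> linarith

lemma dualCell_eq : dualCell b = -dualCenter b +ᵥ parallelepiped (dualBasis b) := by
  ext k
  rw [mem_dualCell_iff, Set.mem_vadd_set_iff_neg_vadd_mem, neg_neg, vadd_eq_add]

lemma isCompact_dualCell : IsCompact (dualCell b) := by
  rw [dualCell_eq]
  exact (dualBasis b).parallelepiped.isCompact.vadd _

lemma dualCell_ae_eq :
    dualCell b =ᵐ[volume]
      (-dualCenter b +ᵥ ZSpan.fundamentalDomain (dualBasis b) : Set (Eu d)) := by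
  rw [dualCell_eq]
  exact (vadd_set_ae_eq _).2 (ZSpan.fundamentalDomain_ae_parallelepiped _ _).symm

lemma isAddFundamentalDomain_dualCell :
    IsAddFundamentalDomain (dualLattice b) (dualCell b) (volume : Measure (Eu d)) := by
  have hdom : IsAddFundamentalDomain (dualLattice b)
      (-dualCenter b +ᵥ ZSpan.fundamentalDomain (dualBasis b) : Set (Eu d)) volume := by
    rw [dualLattice_eq]
    exact (ZSpan.isAddFundamentalDomain' _ _).vadd_of_comm _
  refine ⟨(isCompact_dualCell b).measurableSet.nullMeasurableSet, ?_, fun l l' hl => ?_⟩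
  · refine hdom.ae_covers.mono fun k => Exists.imp fun l hl => ?_
    rw [dualCell_eq]
    exact Set.vadd_set_mono (ZSpan.fundamentalDomain_subset_parallelepiped _) hl
  · exact (hdom.aedisjoint hl).congr ((vadd_set_ae_eq l).2 (dualCell_ae_eq b))
      ((vadd_set_ae_eq l').2 (dualCell_ae_eq b))

lemma volume_dualCell_ne_zero : volume (dualCell b) ≠ 0 :=
  (isAddFundamentalDomain_dualCell b).measure_ne_zero (NeZero.ne _)

lemma finite_setOf_exists_add_mem {K : Set (Eu d)} (hK : IsCompact K) :
    {l : dualLattice b | ∃ k ∈ dualCell b, k + l ∈ K}.Finite := by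
  have hfin := ZSpan.setFinite_inter (dualBasis b)
    (hK.isBounded.sub (isCompact_dualCell b).isBounded)
  refine Set.Finite.of_finite_image (hfin.subset ?_) Subtype.val_injective.injOn
  rintro _ ⟨l, ⟨k, hk, hkl⟩, rfl⟩
  exact ⟨⟨k + l, hkl, k, hk, add_sub_cancel_left _ _⟩, (mem_dualLattice_iff b).1 l.2⟩

/-- The representative of `k` modulo `Γ*` in the half-open version of the cell `Y*`. -/
def cellRep (k : Eu d) : Eu d := ZSpan.fract (dualBasis b) (dualCenter b + k) - dualCenter b

lemma cellRep_add (k : Eu d) (l : dualLattice b) : cellRep b (k + l) = cellRep b k := by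
  rw [cellRep, ← add_assoc, ZSpan.fract_add_ZSpan _ _ ((mem_dualLattice_iff b).1 l.2), cellRep]

lemma cellRep_ae_eq : ∀ᵐ k ∂(volume.restrict (dualCell b)), cellRep b k = k := by
  filter_upwards [ae_restrict_of_ae (dualCell_ae_eq b).mem_iff,
    ae_restrict_mem (isCompact_dualCell b).measurableSet] with k hk hmem
  have hfract := hk.1 hmem
  rw [Set.mem_vadd_set_iff_neg_vadd_mem, neg_neg, vadd_eq_add, ← ZSpan.fract_eq_self] at hfract
  rw [cellRep, hfract, add_sub_cancel_left]

lemma measurable_cellRep : Measurable (cellRep b) := by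
  have hrepr (j : Fin d) : Measurable fun k => (dualBasis b).repr k j :=
    ((dualBasis b).equivFunL.continuous.measurable.eval (a := j))
  have hfract : Measurable (ZSpan.fract (dualBasis b)) := by
    have : ZSpan.fract (dualBasis b) =
        fun k => ∑ j, Int.fract ((dualBasis b).repr k j) • dualBasis b j := by
      ext1 k
      rw [← (dualBasis b).sum_repr (ZSpan.fract (dualBasis b) k)]
      simp only [ZSpan.repr_fract_apply]
    rw [this]
    exact Finset.measurable_fun_sum _ fun j _ => (hrepr j).fract.smul_const _
  exact (hfract.comp (measurable_const_add _)).sub_const _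

/-- `Γ*`-periodicity almost everywhere: each translation by a vector of `Γ*` may fail to preserve
`v` on a null set of its own. -/
def AEPeriodic {F : Type*} (v : Eu d → F) : Prop :=
  ∀ l : dualLattice b, ∀ᵐ k : Eu d, v (k + l) = v k

lemma dualLattice_vadd_eq (l : dualLattice b) (k : Eu d) : l +ᵥ k = k + l :=
  add_comm _ _

lemma exists_lintegral_le {K : Set (Eu d)} (hK : IsCompact K) :
    ∃ N : ℕ, ∀ v : Eu d → ENNReal, AEPeriodic b v →
      ∫⁻ k in K, v k ≤ N * ∫⁻ k in dualCell b, v k := by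
  classical
  have hfin := finite_setOf_exists_add_mem b hK
  refine ⟨hfin.toFinset.card, fun v hv => ?_⟩
  rw [(isAddFundamentalDomain_dualCell b).setLIntegral_eq_tsum',
    ← (Equiv.neg (dualLattice b)).tsum_eq, tsum_eq_sum (s := hfin.toFinset)]
  · rw [← nsmul_eq_mul]
    refine Finset.sum_le_card_nsmul _ _ _ fun l _ =>
      (lintegral_mono_set Set.inter_subset_right).trans_eq
        (lintegral_congr_ae (ae_restrict_of_ae ((hv l).mono fun k hk => ?_)))
    simp only [Equiv.neg_apply, neg_neg, dualLattice_vadd_eq, hk]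
  · intro l hl
    suffices (Equiv.neg (dualLattice b) l +ᵥ K) ∩ dualCell b = ∅ by
      rw [this, Measure.restrict_empty, lintegral_zero_measure]
    refine Set.eq_empty_iff_forall_notMem.2 fun k hk => hl (hfin.mem_toFinset.2 ⟨k, hk.2, ?_⟩)
    simpa only [Equiv.neg_apply, Set.mem_vadd_set_iff_neg_vadd_mem, neg_neg,
      dualLattice_vadd_eq] using hk.1

lemma exists_integral_norm_sq_le {F : Type*} [NormedAddCommGroup F] {K : Set (Eu d)}
    (hK : IsCompact K) :
    ∃ N : ℕ, ∀ v : Eu d → F, AEPeriodic b v → AEStronglyMeasurable v volume →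
      MemLp v 2 (volume.restrict (dualCell b)) →
        MemLp v 2 (volume.restrict K) ∧
        ∫ k in K, ‖v k‖ ^ 2 ≤ N * ∫ k in dualCell b, ‖v k‖ ^ 2 := by
  obtain ⟨N, hN⟩ := exists_lintegral_le b hK
  refine ⟨N, fun v hv hm hL => ?_⟩
  have hnonneg (μ : Measure (Eu d)) : 0 ≤ᵐ[μ] fun k => ‖v k‖ ^ 2 := .of_forall fun _ => sq_nonneg _
  have hle := hN (fun k => ENNReal.ofReal (‖v k‖ ^ 2)) fun l =>
    (hv l).mono fun k hk => congrArg (fun z => ENNReal.ofReal (‖z‖ ^ 2)) hk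
  rw [← ofReal_integral_eq_lintegral_ofReal (integrable_norm_sq hL) (hnonneg _)] at hle
  have hint : Integrable (fun k => ‖v k‖ ^ 2) (volume.restrict K) := by
    refine ⟨hm.restrict.norm.pow 2, ?_⟩
    rw [hasFiniteIntegral_iff_ofReal (hnonneg _)]
    exact hle.trans_lt (ENNReal.mul_lt_top (ENNReal.natCast_lt_top N) ENNReal.ofReal_lt_top)
  refine ⟨(memLp_two_iff_integrable_sq_norm hm.restrict).2 hint, ?_⟩
  rw [← ofReal_integral_eq_lintegral_ofReal hint (hnonneg _), ← ENNReal.ofReal_natCast,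
    ← ENNReal.ofReal_mul N.cast_nonneg] at hle
  exact (ENNReal.ofReal_le_ofReal_iff (by positivity)).1 hle

variable {b}

lemma ae_of_ae_dualCell {p : Eu d → Prop} (hp : ∀ k, ∀ l : dualLattice b, p (k + l) ↔ p k)
    (h : ∀ᵐ k ∂(volume.restrict (dualCell b)), p k) : ∀ᵐ k : Eu d, p k := by
  refine (isAddFundamentalDomain_dualCell b).measure_zero_of_invariant _ (fun l => ?_) ?_
  · ext k
    rw [Set.mem_vadd_set_iff_neg_vadd_mem, dualLattice_vadd_eq]
    exact not_congr (hp k (-l))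
  · rwa [ae_iff, Measure.restrict_apply₀' (isCompact_dualCell b).nullMeasurableSet] at h

lemma AEPeriodic.memL2loc {F : Type*} [NormedAddCommGroup F] {v : Eu d → F} (hv : AEPeriodic b v)
    (hm : AEStronglyMeasurable v volume) (hL : MemLp v 2 (volume.restrict (dualCell b))) :
    MemL2loc v :=
  ⟨hm, fun _ hK => ((exists_integral_norm_sq_le b hK).choose_spec v hv hm hL).1⟩

lemma exists_periodic_extension {F : Type*} [NormedAddCommGroup F] {g : Eu d → F}
    (hg : MemLp g 2 (volume.restrict (dualCell b))) :
    ∃ G : Eu d → F, (∀ k, ∀ l : dualLattice b, G (k + l) = G k) ∧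
      G =ᵐ[volume.restrict (dualCell b)] g ∧ MemL2loc G := by
  have hper (k) (l : dualLattice b) : hg.1.mk g (cellRep b (k + l)) = hg.1.mk g (cellRep b k) := by
    rw [cellRep_add]
  have heq : (fun k => hg.1.mk g (cellRep b k)) =ᵐ[volume.restrict (dualCell b)] g := by
    filter_upwards [hg.1.ae_eq_mk, cellRep_ae_eq b] with k hk hrep
    rw [hrep, hk]
  refine ⟨fun k => hg.1.mk g (cellRep b k), hper, heq, ?_⟩
  exact AEPeriodic.memL2loc (fun l => .of_forall fun k => hper k l)
    (hg.1.stronglyMeasurable_mk.comp_measurable (measurable_cellRep b)).aestronglyMeasurable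
    ((memLp_congr_ae heq).2 hg)

variable (b) in
lemma exists_integral_smul_eq_sum {F : Type*} [NormedAddCommGroup F] [NormedSpace ℂ F]
    {φ : Eu d → ℂ} (hφ : Continuous φ) (hc : HasCompactSupport φ) :
    ∃ S : Finset (dualLattice b), ∀ v : Eu d → F, AEPeriodic b v → LocallyIntegrable v volume →
      ∫ k, φ k • v k = ∑ l ∈ S, ∫ k in dualCell b, φ (k + l) • v k := by
  classical
  have hfin := finite_setOf_exists_add_mem b (K := tsupport φ) hc
  refine ⟨hfin.toFinset, fun v hv hL => ?_⟩
  rw [(isAddFundamentalDomain_dualCell b).integral_eq_tsum'' _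
    (hL.integrable_smul_left_of_hasCompactSupport hφ hc), tsum_eq_sum (s := hfin.toFinset)]
  · refine Finset.sum_congr rfl fun l _ => integral_congr_ae (ae_restrict_of_ae ?_)
    filter_upwards [hv l] with k hk
    rw [dualLattice_vadd_eq, hk]
  · refine fun l hl => setIntegral_eq_zero_of_forall_eq_zero fun k hk => ?_
    have hzero : φ (k + l) = 0 := by
      by_contra h
      exact hl (hfin.mem_toFinset.2 ⟨k, hk, subset_tsupport _ h⟩)
    rw [dualLattice_vadd_eq, hzero, zero_smul]

lemma HasWeakPartial.aePeriodic {F : Type*} [NormedAddCommGroup F] [NormedSpace ℝ F]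
    [CompleteSpace F] {j : Fin d} {u v : Eu d → F} (h : HasWeakPartial j u v)
    (hu : ∀ k, ∀ l : dualLattice b, u (k + l) = u k) : AEPeriodic b v := by
  intro l
  have htranslate := h.comp_add_right (l : Eu d)
  simp only [hu] at htranslate
  exact htranslate.ae_eq h

end DualLattice

section Compactness

variable {d : ℕ} {b : Module.Basis (Fin d) ℝ (Eu d)}

lemma WeaklyTendsto.tendsto_integral_mul_of_aePeriodic {v : ℕ → Eu d → ℂ} {w : Eu d → ℂ}
    (h : WeaklyTendsto (volume.restrict (dualCell b)) v w) (hv : ∀ n, AEPeriodic b (v n))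
    (hvL : ∀ n, LocallyIntegrable (v n) volume) (hw : AEPeriodic b w)
    (hwL : LocallyIntegrable w volume) {φ : Eu d → ℂ} (hφ : Continuous φ)
    (hc : HasCompactSupport φ) :
    Tendsto (fun n => ∫ k, φ k * v n k) atTop (𝓝 (∫ k, φ k * w k)) := by
  obtain ⟨S, hS⟩ := exists_integral_smul_eq_sum b (F := ℂ) hφ hc
  simp only [smul_eq_mul] at hS
  simp only [hS _ (hv _) (hvL _), hS _ hw hwL]
  refine tendsto_finsetSum _ fun l _ => h _ ?_
  exact (memL2loc_of_continuous (by fun_prop)).2 _ (isCompact_dualCell b)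

lemma HasWeakPartial.of_weaklyTendsto {u v : ℕ → Eu d → ℂ} {u' v' : Eu d → ℂ} {j : Fin d}
    (h : ∀ n, HasWeakPartial j (u n) (v n)) (hu' : LocallyIntegrable u' volume)
    (hv' : LocallyIntegrable v' volume)
    (hu : ∀ φ : Eu d → ℂ, Continuous φ → HasCompactSupport φ →
      Tendsto (fun n => ∫ k, φ k * u n k) atTop (𝓝 (∫ k, φ k * u' k)))
    (hv : ∀ φ : Eu d → ℂ, Continuous φ → HasCompactSupport φ →
      Tendsto (fun n => ∫ k, φ k * v n k) atTop (𝓝 (∫ k, φ k * v' k))) :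
    HasWeakPartial j u' v' := by
  refine ⟨hu', hv', fun φ hφ hc => ?_⟩
  have hlim_u := hu (fun x => ((fderiv ℝ φ x (EuclideanSpace.single j 1) : ℝ) : ℂ))
    (Complex.continuous_ofReal.comp (continuous_fderiv_apply_const hφ _))
    ((hc.fderiv_apply (𝕜 := ℝ) _).comp_left (g := fun t : ℝ => (t : ℂ)) rfl)
  have hlim_v := hv (fun x => ((φ x : ℝ) : ℂ)) (Complex.continuous_ofReal.comp hφ.continuous)
    (hc.comp_left (g := fun t : ℝ => (t : ℂ)) rfl)
  simp only [← Complex.real_smul] at hlim_u hlim_v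
  exact tendsto_nhds_unique hlim_u (hlim_v.neg.congr fun n => ((h n).2.2 φ hφ hc).symm)

/-- `u` is a `Γ*`-periodic function on `ℝ^d` representing an element of `W^{1,2}(𝕋*_d)`, with weak
gradient `v`. -/
structure IsPeriodicSobolev (b : Module.Basis (Fin d) ℝ (Eu d)) (u : Eu d → ℂ)
    (v : Fin d → Eu d → ℂ) : Prop where
  periodic : ∀ k, ∀ l : dualLattice b, u (k + l) = u k
  memL2loc : MemL2loc u
  memL2loc_partial : ∀ j, MemL2loc (v j)
  hasWeakPartial : ∀ j, HasWeakPartial j u (v j)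

lemma IsPeriodicSobolev.aePeriodic {u : Eu d → ℂ} {v : Fin d → Eu d → ℂ}
    (h : IsPeriodicSobolev b u v) : AEPeriodic b u :=
  fun l => .of_forall fun k => h.periodic k l

lemma IsPeriodicSobolev.aePeriodic_partial {u : Eu d → ℂ} {v : Fin d → Eu d → ℂ}
    (h : IsPeriodicSobolev b u v) (j : Fin d) : AEPeriodic b (v j) :=
  (h.hasWeakPartial j).aePeriodic h.periodic

lemma IsPeriodicSobolev.sub {u u' : Eu d → ℂ} {v v' : Fin d → Eu d → ℂ}
    (h : IsPeriodicSobolev b u v) (h' : IsPeriodicSobolev b u' v') :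
    IsPeriodicSobolev b (fun k => u k - u' k) (fun j k => v j k - v' j k) where
  periodic k l := by rw [h.periodic, h'.periodic]
  memL2loc := h.memL2loc.sub h'.memL2loc
  memL2loc_partial j := (h.memL2loc_partial j).sub (h'.memL2loc_partial j)
  hasWeakPartial j := (h.hasWeakPartial j).sub (h'.hasWeakPartial j)

lemma IsPeriodicSobolev.memLp {u : Eu d → ℂ} {v : Fin d → Eu d → ℂ}
    (h : IsPeriodicSobolev b u v) : MemLp u 2 (volume.restrict (dualCell b)) :=
  h.memL2loc.2 _ (isCompact_dualCell b)

lemma IsPeriodicSobolev.memLp_partial {u : Eu d → ℂ} {v : Fin d → Eu d → ℂ}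
    (h : IsPeriodicSobolev b u v) (j : Fin d) : MemLp (v j) 2 (volume.restrict (dualCell b)) :=
  (h.memL2loc_partial j).2 _ (isCompact_dualCell b)

lemma IsPeriodicSobolev.of_weaklyTendsto {u : ℕ → Eu d → ℂ} {v : ℕ → Fin d → Eu d → ℂ}
    (h : ∀ n, IsPeriodicSobolev b (u n) (v n)) {u' : Eu d → ℂ} {v' : Fin d → Eu d → ℂ}
    (hu'per : ∀ k, ∀ l : dualLattice b, u' (k + l) = u' k) (hv'per : ∀ j, AEPeriodic b (v' j))
    (hu' : MemL2loc u') (hv' : ∀ j, MemL2loc (v' j))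
    (hu : WeaklyTendsto (volume.restrict (dualCell b)) u u')
    (hv : ∀ j, WeaklyTendsto (volume.restrict (dualCell b)) (fun n => v n j) (v' j)) :
    IsPeriodicSobolev b u' v' where
  periodic := hu'per
  memL2loc := hu'
  memL2loc_partial := hv'
  hasWeakPartial j := by
    refine .of_weaklyTendsto (fun n => (h n).hasWeakPartial j) hu'.locallyIntegrable
      (hv' j).locallyIntegrable (fun φ hφ hc => ?_) (fun φ hφ hc => ?_)
    · exact hu.tendsto_integral_mul_of_aePeriodic (fun n => (h n).aePeriodic)
        (fun n => (h n).memL2loc.locallyIntegrable) (fun l => .of_forall fun k => hu'per k l)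
        hu'.locallyIntegrable hφ hc
    · exact (hv j).tendsto_integral_mul_of_aePeriodic (fun n => (h n).aePeriodic_partial j)
        (fun n => ((h n).memL2loc_partial j).locallyIntegrable) (hv'per j)
        (hv' j).locallyIntegrable hφ hc

lemma exists_smooth_cutoff {K : Set (Eu d)} (hK : IsCompact K) :
    ∃ η : Eu d → ℂ, ContDiff ℝ ∞ η ∧ HasCompactSupport η ∧ ∀ x ∈ K, η x = 1 := by
  obtain ⟨R, hR⟩ := hK.isBounded.subset_closedBall 0
  let f : ContDiffBump (0 : Eu d) := ⟨|R| + 1, |R| + 2, by positivity, by linarith⟩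
  refine ⟨fun x => (f x : ℂ), Complex.ofRealCLM.contDiff.comp f.contDiff,
    f.hasCompactSupport.comp_left (g := fun t : ℝ => (t : ℂ)) rfl, fun x hx => ?_⟩
  have hball : x ∈ Metric.closedBall (0 : Eu d) f.rIn :=
    Metric.closedBall_subset_closedBall ((le_abs_self R).trans (by simp [f])) (hR hx)
  simp [f.one_of_mem_closedBall hball]

lemma tendsto_integral_dualCell_of_weaklyTendsto_zero {w : ℕ → Eu d → ℂ}
    {v : ℕ → Fin d → Eu d → ℂ} (h : ∀ n, IsPeriodicSobolev b (w n) (v n)) {C : ℝ}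
    (hCw : ∀ n, ∫ x in dualCell b, ‖w n x‖ ^ 2 ≤ C)
    (hCv : ∀ n j, ∫ x in dualCell b, ‖v n j x‖ ^ 2 ≤ C)
    (hweak : WeaklyTendsto (volume.restrict (dualCell b)) w fun _ => 0) :
    Tendsto (fun n => ∫ x in dualCell b, ‖w n x‖ ^ 2) atTop (𝓝 0) := by
  have hcell := isCompact_dualCell b
  obtain ⟨η, hη, hc, hη1⟩ := exists_smooth_cutoff hcell
  obtain ⟨N, hN⟩ := exists_integral_norm_sq_le b (F := ℂ) (K := tsupport η) hc
  have hcutoff : Tendsto (fun n => ∫ x, ‖η x • w n x‖ ^ 2) atTop (𝓝 0) := by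
    refine tendsto_integral_smooth_smul_of_weak (C := N * C) (v := fun j n => v n j) hη hc
      (fun n => (h n).memL2loc) (fun j n => (h n).memL2loc_partial j)
      (fun j n => (h n).hasWeakPartial j) (fun n => ?_) (fun j n => ?_) fun φ hφ hφc => ?_
    · refine (hN _ (h n).aePeriodic (h n).memL2loc.1 (h n).memLp).2.trans ?_
      gcongr
      exact hCw n
    · refine (hN _ ((h n).aePeriodic_partial j) ((h n).memL2loc_partial j).1
        ((h n).memLp_partial j)).2.trans ?_
      gcongr
      exact hCv n j
    · simpa using hweak.tendsto_integral_mul_of_aePeriodic (fun n => (h n).aePeriodic)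
        (fun n => (h n).memL2loc.locallyIntegrable) (fun _ => .of_forall fun _ => rfl)
        locallyIntegrable_zero hφ hφc
  refine squeeze_zero (fun n => integral_nonneg fun x => by positivity) (fun n => ?_) hcutoff
  calc ∫ x in dualCell b, ‖w n x‖ ^ 2 = ∫ x in dualCell b, ‖η x • w n x‖ ^ 2 :=
        setIntegral_congr_fun hcell.measurableSet fun x hx => by simp [hη1 x hx]
    _ ≤ ∫ x, ‖η x • w n x‖ ^ 2 := by
        refine setIntegral_le_integral (integrable_norm_sq ?_) (.of_forall fun x => by positivity)
        exact (h n).memL2loc.memLp_smul hη.continuous hc (subset_tsupport η)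

lemma exists_periodic_weaklyTendsto_subseq {ι : Type*} [Finite ι] {v : ι → ℕ → Eu d → ℂ}
    (hv : ∀ i n, MemLp (v i n) 2 (volume.restrict (dualCell b))) {C : ℝ}
    (hC : ∀ i n, ∫ x in dualCell b, ‖v i n x‖ ^ 2 ≤ C) :
    ∃ φ : ℕ → ℕ, StrictMono φ ∧ ∃ w : ι → Eu d → ℂ, ∀ i,
      (∀ k, ∀ l : dualLattice b, w i (k + l) = w i k) ∧ MemL2loc (w i) ∧
      WeaklyTendsto (volume.restrict (dualCell b)) (fun n => v i (φ n)) (w i) := by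
  obtain ⟨φ, hφ, g, hg⟩ := exists_weaklyTendsto_subseq_of_finite v hv C hC
  choose w hper heq hw using fun i => exists_periodic_extension (hg i).1
  exact ⟨φ, hφ, w, fun i => ⟨hper i, hw i, (hg i).2.congr (fun _ => .rfl) (heq i).symm⟩⟩

lemma exists_isPeriodicSobolev_weaklyTendsto_subseq {ι : Type*} [Finite ι]
    {u : ι → ℕ → Eu d → ℂ} {v : ι → ℕ → Fin d → Eu d → ℂ}
    (h : ∀ i n, IsPeriodicSobolev b (u i n) (v i n)) {C : ℝ}
    (hCu : ∀ i n, ∫ x in dualCell b, ‖u i n x‖ ^ 2 ≤ C)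
    (hCv : ∀ i n j, ∫ x in dualCell b, ‖v i n j x‖ ^ 2 ≤ C) :
    ∃ φ : ℕ → ℕ, StrictMono φ ∧ ∃ (u' : ι → Eu d → ℂ) (v' : ι → Fin d → Eu d → ℂ), ∀ i,
      IsPeriodicSobolev b (u' i) (v' i) ∧
      WeaklyTendsto (volume.restrict (dualCell b)) (fun n => u i (φ n)) (u' i) ∧
      ∀ j, WeaklyTendsto (volume.restrict (dualCell b)) (fun n => v i (φ n) j) (v' i j) := by
  let jet (s : ι ⊕ ι × Fin d) (n : ℕ) : Eu d → ℂ :=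
    Sum.elim (fun i => u i n) (fun p => v p.1 n p.2) s
  obtain ⟨φ, hφ, w, hw⟩ := exists_periodic_weaklyTendsto_subseq (b := b) (v := jet)
    (by rintro (i | ⟨i, j⟩) n
        exacts [(h i n).memLp, (h i n).memLp_partial j])
    (by rintro (i | ⟨i, j⟩) n
        exacts [hCu i n, hCv i n j])
  refine ⟨φ, hφ, fun i => w (.inl i), fun i j => w (.inr (i, j)), fun i => ?_⟩
  have hu := hw (.inl i)
  have hv (j : Fin d) := hw (.inr (i, j))
  exact ⟨.of_weaklyTendsto (fun n => h i (φ n)) hu.1 (fun j l => .of_forall fun k => (hv j).1 k l)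
    hu.2.1 (fun j => (hv j).2.1) hu.2.2 (fun j => (hv j).2.2), hu.2.2, fun j => (hv j).2.2⟩

lemma tendsto_integral_norm_sub_sq_of_weaklyTendsto {u : ℕ → Eu d → ℂ} {v : ℕ → Fin d → Eu d → ℂ}
    (h : ∀ n, IsPeriodicSobolev b (u n) (v n)) {C : ℝ}
    (hCu : ∀ n, ∫ x in dualCell b, ‖u n x‖ ^ 2 ≤ C)
    (hCv : ∀ n j, ∫ x in dualCell b, ‖v n j x‖ ^ 2 ≤ C)
    {u' : Eu d → ℂ} {v' : Fin d → Eu d → ℂ} (h' : IsPeriodicSobolev b u' v')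
    (hu : WeaklyTendsto (volume.restrict (dualCell b)) u u')
    (hv : ∀ j, WeaklyTendsto (volume.restrict (dualCell b)) (fun n => v n j) (v' j)) :
    Tendsto (fun n => ∫ x in dualCell b, ‖u n x - u' x‖ ^ 2) atTop (𝓝 0) := by
  have hbound {f : ℕ → Eu d → ℂ} {g : Eu d → ℂ}
      (hf : ∀ n, MemLp (f n) 2 (volume.restrict (dualCell b)))
      (hg : MemLp g 2 (volume.restrict (dualCell b)))
      (hfg : WeaklyTendsto (volume.restrict (dualCell b)) f g)
      (hC : ∀ n, ∫ x in dualCell b, ‖f n x‖ ^ 2 ≤ C) (n : ℕ) :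
      ∫ x in dualCell b, ‖f n x - g x‖ ^ 2 ≤ 4 * C := by
    have hadd := integral_norm_add_sq_le (hf n) hg.neg
    simp only [Pi.neg_apply, ← sub_eq_add_neg, norm_neg] at hadd
    linarith [hC n, hfg.integral_norm_sq_le hf hg hC]
  exact tendsto_integral_dualCell_of_weaklyTendsto_zero (fun n => (h n).sub h')
    (hbound (fun n => (h n).memLp) h'.memLp hu hCu)
    (fun n j => hbound (fun n => (h n).memLp_partial j) (h'.memLp_partial j) (hv j)
      (fun n => hCv n j) n)
    (hu.sub_const (fun n => (h n).memLp) h'.memLp)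

theorem exists_isPeriodicSobolev_tendsto_ae_subseq {ι : Type*} [Finite ι]
    {u : ι → ℕ → Eu d → ℂ} {v : ι → ℕ → Fin d → Eu d → ℂ}
    (h : ∀ i n, IsPeriodicSobolev b (u i n) (v i n)) {C : ℝ}
    (hCu : ∀ i n, ∫ x in dualCell b, ‖u i n x‖ ^ 2 ≤ C)
    (hCv : ∀ i n j, ∫ x in dualCell b, ‖v i n j x‖ ^ 2 ≤ C) :
    ∃ φ : ℕ → ℕ, StrictMono φ ∧ ∃ (u' : ι → Eu d → ℂ) (v' : ι → Fin d → Eu d → ℂ),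
      (∀ i, IsPeriodicSobolev b (u' i) (v' i)) ∧
      (∀ᵐ k : Eu d, ∀ i, Tendsto (fun n => u i (φ n) k) atTop (𝓝 (u' i k))) ∧
      ∀ i j, WeaklyTendsto (volume.restrict (dualCell b)) (fun n => v i (φ n) j) (v' i j) := by
  obtain ⟨φ, hφ, u', v', hlim⟩ := exists_isPeriodicSobolev_weaklyTendsto_subseq h hCu hCv
  have hstrong (i : ι) :
      Tendsto (fun n => ∫ x in dualCell b, ‖u i (φ n) x - u' i x‖ ^ 2) atTop (𝓝 0) :=
    tendsto_integral_norm_sub_sq_of_weaklyTendsto (fun n => h i (φ n)) (fun n => hCu i _)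
      (fun n j => hCv i _ j) (hlim i).1 (hlim i).2.1 (hlim i).2.2
  obtain ⟨ψ, hψ, hae⟩ := exists_subseq_tendsto_ae_of_integral_norm_sq
    (fun i n => (h i (φ n)).memLp.sub (hlim i).1.memLp) hstrong
  refine ⟨φ ∘ ψ, hφ.comp hψ, u', v', fun i => (hlim i).1, ?_,
    fun i j => ((hlim i).2.2 j).comp hψ.tendsto_atTop⟩
  refine ae_of_ae_dualCell (b := b) (fun k l => ?_) (hae.mono fun k hk i => ?_)
  · simp only [(h _ _).periodic, (hlim _).1.periodic]
  · exact tendsto_sub_nhds_zero_iff.1 (hk i)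

end Compactness

/-! ### The energy of a unitary field -/

section Matrix

variable {n : Type*} [Fintype n]

/-- The squared Frobenius norm of a complex matrix. -/
def frobSq (w : Matrix n n ℂ) : ℝ := ∑ p, ∑ q, ‖w p q‖ ^ 2

/-- The anti-Hermitian part of a matrix. -/
def skewPart (A : Matrix n n ℂ) : Matrix n n ℂ := (1 / 2 : ℂ) • (A - Aᴴ)

/-- The covariant derivative of the gauge `u`, with derivative `v`, for the anti-Hermitian part of
the connection `A`. -/
def covariantDeriv (A u v : Matrix n n ℂ) : Matrix n n ℂ := v + skewPart A * u

/-- The matrix `Uᴴ (∂U + A U)`, whose diagonal entries are averaged in the localization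
functional; `v` stands for `∂U`. -/
def covariantPart (A u v : Matrix n n ℂ) : Matrix n n ℂ := uᴴ * (v + A * u)

lemma frobSq_nonneg (w : Matrix n n ℂ) : 0 ≤ frobSq w := by
  unfold frobSq
  positivity

lemma re_trace_conjTranspose_mul_self (w : Matrix n n ℂ) : (wᴴ * w).trace.re = frobSq w := by
  rw [frobSq, Finset.sum_comm]
  simp [Matrix.trace, Matrix.mul_apply, Complex.sq_norm, Complex.normSq_apply]

lemma re_trace_conjTranspose (w : Matrix n n ℂ) : wᴴ.trace.re = w.trace.re := by
  simp [Matrix.trace_conjTranspose]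

lemma frobSq_add (v w : Matrix n n ℂ) :
    frobSq (v + w) = frobSq v + 2 * (vᴴ * w).trace.re + frobSq w := by
  have hcross : (wᴴ * v).trace.re = (vᴴ * w).trace.re := by
    rw [← re_trace_conjTranspose, Matrix.conjTranspose_mul, Matrix.conjTranspose_conjTranspose]
  simp only [← re_trace_conjTranspose_mul_self, Matrix.conjTranspose_add, Matrix.add_mul,
    Matrix.mul_add, Matrix.trace_add, Complex.add_re, hcross]
  ring

lemma frobSq_add_le (v w : Matrix n n ℂ) : frobSq (v + w) ≤ 2 * frobSq v + 2 * frobSq w := by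
  simp only [frobSq, Finset.mul_sum, ← Finset.sum_add_distrib]
  refine Finset.sum_le_sum fun p _ => Finset.sum_le_sum fun q _ => ?_
  have htri := pow_le_pow_left₀ (norm_nonneg _) (norm_add_le (v p q) (w p q)) 2
  simp only [Matrix.add_apply]
  nlinarith [sq_nonneg (‖v p q‖ - ‖w p q‖)]

lemma frobSq_neg (w : Matrix n n ℂ) : frobSq (-w) = frobSq w := by
  simp only [frobSq, Matrix.neg_apply, norm_neg]

section Unitary

variable [DecidableEq n]

lemma frobSq_mul_unitary (w : Matrix n n ℂ) {u : Matrix n n ℂ}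
    (hu : u ∈ Matrix.unitaryGroup n ℂ) : frobSq (w * u) = frobSq w := by
  have huu : u * uᴴ = 1 := Matrix.mem_unitaryGroup_iff.1 hu
  rw [← re_trace_conjTranspose_mul_self, ← re_trace_conjTranspose_mul_self,
    Matrix.conjTranspose_mul, Matrix.mul_assoc, Matrix.trace_mul_comm, Matrix.mul_assoc,
    Matrix.mul_assoc, huu, Matrix.mul_one]

lemma frobSq_conjTranspose_unitary_mul {u : Matrix n n ℂ} (hu : u ∈ Matrix.unitaryGroup n ℂ)
    (w : Matrix n n ℂ) : frobSq (uᴴ * w) = frobSq w := by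
  have huu : u * uᴴ = 1 := Matrix.mem_unitaryGroup_iff.1 hu
  rw [← re_trace_conjTranspose_mul_self, ← re_trace_conjTranspose_mul_self,
    Matrix.conjTranspose_mul, Matrix.conjTranspose_conjTranspose, Matrix.mul_assoc,
    ← Matrix.mul_assoc u, huu, Matrix.one_mul]

lemma frobSq_diagonal (D : n → ℂ) : frobSq (Matrix.diagonal D) = ∑ a, ‖D a‖ ^ 2 := by
  refine Finset.sum_congr rfl fun a _ => ?_
  rw [Finset.sum_eq_single a (fun q _ hq => by simp [Matrix.diagonal_apply_ne' D hq]) (by simp),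
    Matrix.diagonal_apply_eq]

lemma frobSq_add_diagonal_I_mul (w : Matrix n n ℂ) (δ : n → ℝ) :
    frobSq (w + Matrix.diagonal fun a => Complex.I * δ a)
      = frobSq w + ∑ a, (2 * δ a * (w a a).im + δ a ^ 2) := by
  have hcross : (wᴴ * Matrix.diagonal fun a => Complex.I * (δ a : ℂ)).trace.re
      = ∑ a, δ a * (w a a).im := by
    simp [Matrix.trace, Matrix.mul_diagonal, mul_comm]
  rw [frobSq_add, hcross, frobSq_diagonal, Finset.mul_sum, add_assoc, ← Finset.sum_add_distrib]
  simp [mul_assoc]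

lemma re_trace_add_trace_mul_eq {A u v : Matrix n n ℂ} (hu : u ∈ Matrix.unitaryGroup n ℂ) :
    ((vᴴ * v).trace + ((u * vᴴ - v * uᴴ) * A).trace).re
      = frobSq (covariantDeriv A u v) - frobSq (skewPart A) := by
  have hleft : (u * vᴴ * A).trace = (vᴴ * (A * u)).trace := by
    rw [Matrix.mul_assoc, Matrix.trace_mul_comm, Matrix.mul_assoc]
  have hright : (v * uᴴ * A).trace.re = (vᴴ * (Aᴴ * u)).trace.re := by
    rw [← re_trace_conjTranspose, Matrix.conjTranspose_mul, Matrix.conjTranspose_mul,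
      Matrix.conjTranspose_conjTranspose, ← Matrix.mul_assoc, Matrix.trace_mul_comm]
  have hcross : 2 * (vᴴ * (skewPart A * u)).trace.re
      = (vᴴ * (A * u)).trace.re - (vᴴ * (Aᴴ * u)).trace.re := by
    rw [skewPart, Matrix.smul_mul, Matrix.mul_smul, Matrix.trace_smul, Matrix.sub_mul,
      Matrix.mul_sub, Matrix.trace_sub]
    simp
  rw [covariantDeriv, frobSq_add, frobSq_mul_unitary _ hu, hcross, Complex.add_re, Matrix.sub_mul,
    Matrix.trace_sub, Complex.sub_re, hleft, hright, re_trace_conjTranspose_mul_self]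
  ring

lemma frobSq_le_covariantDeriv {A u : Matrix n n ℂ} (hu : u ∈ Matrix.unitaryGroup n ℂ)
    (v : Matrix n n ℂ) :
    frobSq v ≤ 2 * frobSq (covariantDeriv A u v) + 2 * frobSq (skewPart A) := by
  have hle := frobSq_add_le (covariantDeriv A u v) (-(skewPart A * u))
  rwa [frobSq_neg, frobSq_mul_unitary _ hu, covariantDeriv, add_neg_cancel_right] at hle

end Unitary

omit [Fintype n] in
lemma im_sub_skewPart_diag (A : Matrix n n ℂ) (a : n) : ((A - skewPart A) a a).im = 0 := by
  have hhalf : (1 / 2 : ℂ) = ((1 / 2 : ℝ) : ℂ) := by norm_num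
  rw [skewPart, hhalf, Matrix.sub_apply, Matrix.smul_apply, Matrix.sub_apply,
    Matrix.conjTranspose_apply, Complex.sub_im, smul_eq_mul, Complex.im_ofReal_mul,
    Complex.sub_im, Complex.star_def, Complex.conj_im]
  ring

lemma skewPart_conjTranspose_mul_mul (A u : Matrix n n ℂ) :
    skewPart (uᴴ * (A * u)) = uᴴ * (skewPart A * u) := by
  simp only [skewPart, Matrix.conjTranspose_mul, Matrix.conjTranspose_conjTranspose,
    Matrix.smul_mul, Matrix.mul_smul, Matrix.sub_mul, Matrix.mul_sub, Matrix.mul_assoc]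

lemma im_covariantPart_diag (A u v : Matrix n n ℂ) (a : n) :
    (covariantPart A u v a a).im = ((uᴴ * covariantDeriv A u v) a a).im := by
  have hskew := im_sub_skewPart_diag (uᴴ * (A * u)) a
  rw [skewPart_conjTranspose_mul_mul, Matrix.sub_apply, Complex.sub_im, sub_eq_zero] at hskew
  simp only [covariantPart, covariantDeriv, Matrix.mul_add, Matrix.add_apply, Complex.add_im,
    hskew]

section Gauge

variable [DecidableEq n] {A u v : Matrix n n ℂ} {D : n → ℂ}

lemma diagonal_mem_unitaryGroup (hD : ∀ a, star (D a) * D a = 1) :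
    Matrix.diagonal D ∈ Matrix.unitaryGroup n ℂ := by
  rw [Matrix.mem_unitaryGroup_iff', Matrix.star_eq_conjTranspose, Matrix.diagonal_conjTranspose,
    Matrix.diagonal_mul_diagonal, ← Matrix.diagonal_one]
  congr 1
  ext a
  exact hD a

lemma covariantPart_mul_diagonal (hu : u ∈ Matrix.unitaryGroup n ℂ)
    (hD : ∀ a, star (D a) * D a = 1) (δ : n → ℝ) (a : n) :
    covariantPart A (u * Matrix.diagonal D)
      ((v + u * Matrix.diagonal fun a => Complex.I * δ a) * Matrix.diagonal D) a a
      = covariantPart A u v a a + Complex.I * δ a := by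
  have huu : uᴴ * u = 1 := Matrix.mem_unitaryGroup_iff'.1 hu
  have hconj : covariantPart A (u * Matrix.diagonal D)
      ((v + u * Matrix.diagonal fun a => Complex.I * δ a) * Matrix.diagonal D)
      = Matrix.diagonal (star D) * ((covariantPart A u v + Matrix.diagonal fun a => Complex.I * δ a)
        * Matrix.diagonal D) := by
    simp only [covariantPart, Matrix.conjTranspose_mul, Matrix.diagonal_conjTranspose,
      Matrix.mul_assoc, Matrix.add_mul, Matrix.mul_add]
    rw [← Matrix.mul_assoc uᴴ u, huu, Matrix.one_mul]
    abel
  rw [hconj, Matrix.diagonal_mul, Matrix.mul_diagonal, Matrix.add_apply, Matrix.diagonal_apply_eq,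
    Pi.star_apply]
  linear_combination (covariantPart A u v a a + Complex.I * δ a) * hD a

lemma frobSq_covariantDeriv_mul_diagonal (hu : u ∈ Matrix.unitaryGroup n ℂ)
    (hD : ∀ a, star (D a) * D a = 1) (δ : n → ℝ) :
    frobSq (covariantDeriv A (u * Matrix.diagonal D)
      ((v + u * Matrix.diagonal fun a => Complex.I * δ a) * Matrix.diagonal D))
      = frobSq (covariantDeriv A u v)
        + ∑ a, (2 * δ a * (covariantPart A u v a a).im + δ a ^ 2) := by
  have huu : uᴴ * u = 1 := Matrix.mem_unitaryGroup_iff'.1 hu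
  have hcov : covariantDeriv A (u * Matrix.diagonal D)
      ((v + u * Matrix.diagonal fun a => Complex.I * δ a) * Matrix.diagonal D)
      = (covariantDeriv A u v + u * Matrix.diagonal fun a => Complex.I * δ a)
        * Matrix.diagonal D := by
    simp only [covariantDeriv, Matrix.add_mul, Matrix.mul_assoc]
    abel
  rw [hcov, frobSq_mul_unitary _ (diagonal_mem_unitaryGroup hD),
    ← frobSq_conjTranspose_unitary_mul hu, Matrix.mul_add, ← Matrix.mul_assoc uᴴ u, huu,
    Matrix.one_mul, frobSq_add_diagonal_I_mul, frobSq_conjTranspose_unitary_mul hu]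
  simp only [im_covariantPart_diag]

end Gauge

end Matrix

section Energy

variable {n X : Type*} [Fintype n] [MeasurableSpace X] {μ : Measure X}

/-- Square integrability of all the entries of a matrix-valued function. -/
def MatrixMemL2 (μ : Measure X) (A : X → Matrix n n ℂ) : Prop :=
  ∀ p q, MemLp (fun x => A x p q) 2 μ

/-- The contribution of one direction to the localization functional, up to a constant which does
not depend on the gauge: `u` stands for the gauge, `v` for its derivative and `A` for the
connection. -/
def gaugeEnergy (μ : Measure X) (A u v : X → Matrix n n ℂ) : ℝ :=
  ∫ x, frobSq (covariantDeriv (A x) (u x) (v x)) ∂μ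
    + ∑ a, ((∫ x, covariantPart (A x) (u x) (v x) a a ∂μ) ^ 2).re

variable {A B u v : X → Matrix n n ℂ}

omit [Fintype n] in
lemma MatrixMemL2.skewPart (hA : MatrixMemL2 μ A) : MatrixMemL2 μ fun x => skewPart (A x) :=
  fun p q => ((hA p q).sub (hA q p).star).const_mul _

lemma MatrixMemL2.integrable_frobSq (hA : MatrixMemL2 μ A) :
    Integrable (fun x => frobSq (A x)) μ :=
  integrable_finsetSum _ fun p _ => integrable_finsetSum _ fun q _ => integrable_norm_sq (hA p q)

lemma MatrixMemL2.integral_frobSq (hA : MatrixMemL2 μ A) :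
    ∫ x, frobSq (A x) ∂μ = ∑ p, ∑ q, ∫ x, ‖A x p q‖ ^ 2 ∂μ := by
  simp only [frobSq]
  rw [integral_finsetSum _ fun p _ =>
    integrable_finsetSum _ fun q _ => integrable_norm_sq (hA p q)]
  exact Finset.sum_congr rfl fun p _ => integral_finsetSum _ fun q _ => integrable_norm_sq (hA p q)

lemma MatrixMemL2.integral_norm_sq_apply_le (hA : MatrixMemL2 μ A) (p q : n) :
    ∫ x, ‖A x p q‖ ^ 2 ∂μ ≤ ∫ x, frobSq (A x) ∂μ := by
  rw [hA.integral_frobSq]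
  exact (Finset.single_le_sum (f := fun q => ∫ x, ‖A x p q‖ ^ 2 ∂μ)
    (fun q _ => by positivity) (Finset.mem_univ q)).trans
    (Finset.single_le_sum (f := fun p => ∑ q, ∫ x, ‖A x p q‖ ^ 2 ∂μ)
      (fun p _ => by positivity) (Finset.mem_univ p))

omit [Fintype n] in
lemma MatrixMemL2.conjTranspose (hA : MatrixMemL2 μ A) : MatrixMemL2 μ fun x => (A x)ᴴ :=
  fun p q => (hA q p).star

lemma MatrixMemL2.integrable_trace_mul (hA : MatrixMemL2 μ A) (hB : MatrixMemL2 μ B) :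
    Integrable (fun x => (A x * B x).trace) μ :=
  integrable_finsetSum _ fun p _ => by
    simp only [Matrix.diag_apply, Matrix.mul_apply]
    exact integrable_finsetSum _ fun q _ => (hA p q).integrable_mul (hB q p)

lemma neg_sq_le_re_sq {z : ℂ} {R : ℝ} (hz : |z.im| ≤ R) : -R ^ 2 ≤ (z ^ 2).re := by
  have hsq : z.im ^ 2 ≤ R ^ 2 := sq_le_sq.2 (hz.trans (le_abs_self R))
  rw [sq z, Complex.mul_re]
  nlinarith [sq_nonneg z.re]

variable [DecidableEq n]

/-- Almost everywhere strongly measurable maps into the unitary group. -/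
structure IsUnitaryField (μ : Measure X) (u : X → Matrix n n ℂ) : Prop where
  mem_unitaryGroup (x : X) : u x ∈ Matrix.unitaryGroup n ℂ
  aestronglyMeasurable (p q : n) : AEStronglyMeasurable (fun x => u x p q) μ

lemma IsUnitaryField.norm_apply_le (hu : IsUnitaryField μ u) (x : X) (p q : n) :
    ‖u x p q‖ ≤ 1 :=
  entry_norm_bound_of_unitary (hu.mem_unitaryGroup x) p q

lemma IsUnitaryField.memLp_mul (hu : IsUnitaryField μ u) {f : X → ℂ} (hf : MemLp f 2 μ) (p q : n) :
    MemLp (fun x => u x p q * f x) 2 μ :=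
  memLp_mul_of_norm_le_one (hu.aestronglyMeasurable p q)
    (.of_forall fun x => hu.norm_apply_le x p q) hf

lemma IsUnitaryField.memLp_star_mul (hu : IsUnitaryField μ u) {f : X → ℂ} (hf : MemLp f 2 μ)
    (p q : n) : MemLp (fun x => star (u x p q) * f x) 2 μ :=
  memLp_mul_of_norm_le_one (hu.aestronglyMeasurable p q).star
    (.of_forall fun x => (norm_star _).trans_le (hu.norm_apply_le x p q)) hf

lemma MatrixMemL2.add_mul (hv : MatrixMemL2 μ v) (hA : MatrixMemL2 μ A)
    (hu : IsUnitaryField μ u) : MatrixMemL2 μ fun x => v x + A x * u x := by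
  intro p q
  simp only [Matrix.add_apply, Matrix.mul_apply, mul_comm (A _ _ _)]
  exact (hv p q).add (memLp_finsetSum _ fun r _ => hu.memLp_mul (hA p r) r q)

lemma MatrixMemL2.covariantDeriv (hu : IsUnitaryField μ u) (hA : MatrixMemL2 μ A)
    (hv : MatrixMemL2 μ v) : MatrixMemL2 μ fun x => covariantDeriv (A x) (u x) (v x) :=
  hv.add_mul hA.skewPart hu

lemma MatrixMemL2.covariantPart (hu : IsUnitaryField μ u) (hA : MatrixMemL2 μ A)
    (hv : MatrixMemL2 μ v) : MatrixMemL2 μ fun x => covariantPart (A x) (u x) (v x) := by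
  intro p q
  simp only [BlochMV.covariantPart, Matrix.mul_apply (M := (u _)ᴴ), Matrix.conjTranspose_apply]
  exact memLp_finsetSum _ fun r _ => hu.memLp_star_mul (hv.add_mul hA hu r q) r p

lemma MatrixMemL2.mul_conjTranspose_sub (hu : IsUnitaryField μ u) (hv : MatrixMemL2 μ v) :
    MatrixMemL2 μ fun x => u x * (v x)ᴴ - v x * (u x)ᴴ := by
  intro p q
  simp only [Matrix.sub_apply, Matrix.mul_apply, Matrix.conjTranspose_apply, mul_comm (v _ _ _)]
  exact (memLp_finsetSum _ fun r _ => hu.memLp_mul (hv q r).star p r).sub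
    (memLp_finsetSum _ fun r _ => hu.memLp_star_mul (hv p r) q r)

lemma re_integral_trace_add_eq (hu : IsUnitaryField μ u) (hA : MatrixMemL2 μ A)
    (hv : MatrixMemL2 μ v) :
    (∫ x, ((v x)ᴴ * v x).trace ∂μ
        + ∫ x, ((u x * (v x)ᴴ - v x * (u x)ᴴ) * A x).trace ∂μ).re
      = ∫ x, frobSq (covariantDeriv (A x) (u x) (v x)) ∂μ
        - ∫ x, frobSq (skewPart (A x)) ∂μ := by
  have hvv := hv.conjTranspose.integrable_trace_mul hv
  have hcross := (MatrixMemL2.mul_conjTranspose_sub hu hv).integrable_trace_mul hA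
  have hre := integral_re (hvv.add hcross)
  simp only [RCLike.re_to_complex, Pi.add_apply] at hre
  rw [← integral_add hvv hcross, ← hre, ← integral_sub
    (MatrixMemL2.covariantDeriv hu hA hv).integrable_frobSq hA.skewPart.integrable_frobSq]
  exact integral_congr_ae
    (.of_forall fun x => re_trace_add_trace_mul_eq (hu.mem_unitaryGroup x))

lemma MatrixMemL2.integral_frobSq_add_mul_le (hv : MatrixMemL2 μ v) (hA : MatrixMemL2 μ A)
    (hu : IsUnitaryField μ u) : ∫ x, frobSq (v x + A x * u x) ∂μ
      ≤ 2 * ∫ x, frobSq (v x) ∂μ + 2 * ∫ x, frobSq (A x) ∂μ := by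
  have hv' := hv.integrable_frobSq.const_mul 2
  have hA' := hA.integrable_frobSq.const_mul 2
  rw [← integral_const_mul, ← integral_const_mul, ← integral_add hv' hA']
  refine integral_mono (hv.add_mul hA hu).integrable_frobSq (hv'.add hA') fun x => ?_
  simpa only [Pi.add_apply, frobSq_mul_unitary _ (hu.mem_unitaryGroup x)]
    using frobSq_add_le (v x) (A x * u x)

lemma integral_frobSq_le_gaugeEnergy (hu : IsUnitaryField μ u) (hA : MatrixMemL2 μ A)
    (hv : MatrixMemL2 μ v) {R : ℝ}
    (hR : ∀ a, |(∫ x, covariantPart (A x) (u x) (v x) a a ∂μ).im| ≤ R) :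
    ∫ x, frobSq (v x) ∂μ ≤ 2 * (gaugeEnergy μ A u v + Fintype.card n * R ^ 2)
      + 2 * ∫ x, frobSq (skewPart (A x)) ∂μ := by
  have hW := (MatrixMemL2.covariantDeriv hu hA hv).integrable_frobSq.const_mul 2
  have hS := hA.skewPart.integrable_frobSq.const_mul 2
  have hderiv : ∫ x, frobSq (v x) ∂μ ≤ 2 * ∫ x, frobSq (covariantDeriv (A x) (u x) (v x)) ∂μ
      + 2 * ∫ x, frobSq (skewPart (A x)) ∂μ := by
    rw [← integral_const_mul, ← integral_const_mul, ← integral_add hW hS]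
    exact integral_mono hv.integrable_frobSq (hW.add hS) fun x =>
      frobSq_le_covariantDeriv (hu.mem_unitaryGroup x) (v x)
  have hmean : -(Fintype.card n * R ^ 2)
      ≤ ∑ a, ((∫ x, covariantPart (A x) (u x) (v x) a a ∂μ) ^ 2).re := by
    have hsum := Finset.sum_le_sum fun a (_ : a ∈ Finset.univ) => neg_sq_le_re_sq (hR a)
    simpa only [Finset.sum_const, Finset.card_univ, nsmul_eq_mul, mul_neg] using hsum
  rw [gaugeEnergy]
  linarith

section Convergence

variable {U V : ℕ → X → Matrix n n ℂ}

lemma weaklyTendsto_add_mul_apply (hA : MatrixMemL2 μ A) (hU : ∀ i, IsUnitaryField μ (U i))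
    (hV : ∀ i, MatrixMemL2 μ (V i)) (hu : IsUnitaryField μ u) (hv : MatrixMemL2 μ v)
    (hUu : ∀ᵐ x ∂μ, ∀ p q, Tendsto (fun i => U i x p q) atTop (𝓝 (u x p q)))
    (hVv : ∀ p q, WeaklyTendsto μ (fun i x => V i x p q) (fun x => v x p q)) (p q : n) :
    WeaklyTendsto μ (fun i x => (V i x + A x * U i x) p q) (fun x => (v x + A x * u x) p q) := by
  intro g hg
  have hsplit {u v : X → Matrix n n ℂ} (hu : IsUnitaryField μ u) (hv : MatrixMemL2 μ v) :
      ∫ x, g x * (v x + A x * u x) p q ∂μ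
        = ∫ x, g x * v x p q ∂μ + ∑ r, ∫ x, u x r q * g x * A x p r ∂μ := by
    have hv' : Integrable (fun x => g x * v x p q) μ := hg.integrable_mul (hv p q)
    have hA' (r : n) : Integrable (fun x => u x r q * g x * A x p r) μ :=
      (hu.memLp_mul hg r q).integrable_mul (hA p r)
    rw [← integral_finsetSum _ fun r _ => hA' r,
      ← integral_add hv' (integrable_finsetSum _ fun r _ => hA' r)]
    refine integral_congr_ae (.of_forall fun x => ?_)
    simp only [Matrix.add_apply, Matrix.mul_apply, mul_add, Finset.mul_sum]
    congr 1
    exact Finset.sum_congr rfl fun r _ => by ring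
  simp only [hsplit (hU _) (hV _), hsplit hu hv]
  refine (hVv p q g hg).add (tendsto_finsetSum _ fun r _ => ?_)
  have hconst : WeaklyTendsto μ (fun _ x => A x p r) (fun x => A x p r) :=
    fun _ _ => tendsto_const_nhds
  exact hconst.tendsto_integral_mul_mul (fun _ => hA p r) (fun _ => le_rfl)
    (fun i => (hU i).aestronglyMeasurable r q) (fun i x => (hU i).norm_apply_le x r q)
    (hUu.mono fun x hx => hx r q) hg

variable [IsFiniteMeasure μ]

lemma tendsto_integral_covariantPart (hA : MatrixMemL2 μ A) (hU : ∀ i, IsUnitaryField μ (U i))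
    (hV : ∀ i, MatrixMemL2 μ (V i)) (hu : IsUnitaryField μ u) (hv : MatrixMemL2 μ v) {C : ℝ}
    (hC : ∀ i, ∫ x, frobSq (V i x) ∂μ ≤ C)
    (hUu : ∀ᵐ x ∂μ, ∀ p q, Tendsto (fun i => U i x p q) atTop (𝓝 (u x p q)))
    (hVv : ∀ p q, WeaklyTendsto μ (fun i x => V i x p q) (fun x => v x p q)) (p q : n) :
    Tendsto (fun i => ∫ x, covariantPart (A x) (U i x) (V i x) p q ∂μ) atTop
      (𝓝 (∫ x, covariantPart (A x) (u x) (v x) p q ∂μ)) := by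
  have hsplit {u v : X → Matrix n n ℂ} (hu : IsUnitaryField μ u) (hv : MatrixMemL2 μ v) :
      ∫ x, covariantPart (A x) (u x) (v x) p q ∂μ
        = ∑ r, ∫ x, star (u x r p) * 1 * (v x + A x * u x) r q ∂μ := by
    simp only [mul_one]
    rw [← integral_finsetSum _ fun r _ =>
      (hu.memLp_star_mul (hv.add_mul hA hu r q) r p).integrable one_le_two]
    simp only [covariantPart, Matrix.mul_apply (M := (u _)ᴴ), Matrix.conjTranspose_apply]
  have hbound (i : ℕ) (r : n) :
      ∫ x, ‖(V i x + A x * U i x) r q‖ ^ 2 ∂μ ≤ 2 * C + 2 * ∫ x, frobSq (A x) ∂μ :=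
    ((hV i).add_mul hA (hU i)).integral_norm_sq_apply_le r q |>.trans <|
      ((hV i).integral_frobSq_add_mul_le hA (hU i)).trans <| by linarith [hC i]
  simp only [hsplit (hU _) (hV _), hsplit hu hv]
  refine tendsto_finsetSum _ fun r _ => ?_
  exact (weaklyTendsto_add_mul_apply hA hU hV hu hv hUu hVv r q).tendsto_integral_mul_mul
    (fun i => (hV i).add_mul hA (hU i) r q) (fun i => hbound i r)
    (fun i => ((hU i).aestronglyMeasurable r p).star)
    (fun i x => (norm_star _).trans_le ((hU i).norm_apply_le x r p))
    (hUu.mono fun x hx => (hx r p).star) (memLp_const 1)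

/-- Lower semicontinuity of the energy. Stated by a convergent sequence of lower bounds, it needs no
bound on the limit inferior and can be summed over the directions. -/
lemma exists_tendsto_le_gaugeEnergy (hA : MatrixMemL2 μ A) (hU : ∀ i, IsUnitaryField μ (U i))
    (hV : ∀ i, MatrixMemL2 μ (V i)) (hu : IsUnitaryField μ u) (hv : MatrixMemL2 μ v) {C : ℝ}
    (hC : ∀ i, ∫ x, frobSq (V i x) ∂μ ≤ C)
    (hUu : ∀ᵐ x ∂μ, ∀ p q, Tendsto (fun i => U i x p q) atTop (𝓝 (u x p q)))
    (hVv : ∀ p q, WeaklyTendsto μ (fun i x => V i x p q) (fun x => v x p q)) :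
    ∃ l : ℕ → ℝ, (∀ i, l i ≤ gaugeEnergy μ A (U i) (V i)) ∧
      Tendsto l atTop (𝓝 (gaugeEnergy μ A u v)) := by
  have hW := weaklyTendsto_add_mul_apply hA.skewPart hU hV hu hv hUu hVv
  choose l hle hlim using fun p q => (hW p q).exists_tendsto_le_integral_norm_sq
    (fun i => MatrixMemL2.covariantDeriv (hU i) hA (hV i) p q)
    (MatrixMemL2.covariantDeriv hu hA hv p q)
  refine ⟨fun i => ∑ p, ∑ q, l p q i
    + ∑ a, ((∫ x, covariantPart (A x) (U i x) (V i x) a a ∂μ) ^ 2).re, fun i => ?_, ?_⟩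
  · rw [gaugeEnergy, (MatrixMemL2.covariantDeriv (hU i) hA (hV i)).integral_frobSq]
    exact add_le_add_left
      (Finset.sum_le_sum fun p _ => Finset.sum_le_sum fun q _ => hle p q i) _
  · rw [gaugeEnergy, (MatrixMemL2.covariantDeriv hu hA hv).integral_frobSq]
    exact (tendsto_finsetSum _ fun p _ => tendsto_finsetSum _ fun q _ => hlim p q).add
      (tendsto_finsetSum _ fun a _ => (Complex.continuous_re.tendsto _).comp
        ((tendsto_integral_covariantPart hA hU hV hu hv hC hUu hVv a a).pow 2))

end Convergence

section GaugeChange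

variable [IsProbabilityMeasure μ] {D : X → n → ℂ} {δ : n → ℝ} {u' v' : X → Matrix n n ℂ}

lemma integral_covariantPart_mul_diagonal (hu : IsUnitaryField μ u) (hA : MatrixMemL2 μ A)
    (hv : MatrixMemL2 μ v) (hD : ∀ x a, star (D x a) * D x a = 1)
    (hu' : ∀ᵐ x ∂μ, u' x = u x * Matrix.diagonal (D x))
    (hv' : ∀ᵐ x ∂μ, v' x = (v x + u x * Matrix.diagonal fun a => Complex.I * δ a)
      * Matrix.diagonal (D x)) (a : n) :
    ∫ x, covariantPart (A x) (u' x) (v' x) a a ∂μ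
      = ∫ x, covariantPart (A x) (u x) (v x) a a ∂μ + Complex.I * δ a := by
  have hshift : ∫ x, covariantPart (A x) (u' x) (v' x) a a ∂μ
      = ∫ x, (covariantPart (A x) (u x) (v x) a a + Complex.I * δ a) ∂μ := by
    refine integral_congr_ae ?_
    filter_upwards [hu', hv'] with x hux hvx
    rw [hux, hvx, covariantPart_mul_diagonal (hu.mem_unitaryGroup x) (hD x)]
  rw [hshift, integral_add ((MatrixMemL2.covariantPart hu hA hv a a).integrable one_le_two)
    (integrable_const _), integral_const, probReal_univ, one_smul]

lemma integral_frobSq_covariantDeriv_mul_diagonal (hu : IsUnitaryField μ u)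
    (hA : MatrixMemL2 μ A) (hv : MatrixMemL2 μ v) (hD : ∀ x a, star (D x a) * D x a = 1)
    (hu' : ∀ᵐ x ∂μ, u' x = u x * Matrix.diagonal (D x))
    (hv' : ∀ᵐ x ∂μ, v' x = (v x + u x * Matrix.diagonal fun a => Complex.I * δ a)
      * Matrix.diagonal (D x)) :
    ∫ x, frobSq (covariantDeriv (A x) (u' x) (v' x)) ∂μ
      = ∫ x, frobSq (covariantDeriv (A x) (u x) (v x)) ∂μ
        + ∑ a, (2 * δ a * (∫ x, covariantPart (A x) (u x) (v x) a a ∂μ).im + δ a ^ 2) := by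
  have hpart (a : n) : Integrable (fun x => covariantPart (A x) (u x) (v x) a a) μ :=
    (MatrixMemL2.covariantPart hu hA hv a a).integrable one_le_two
  have him (a : n) : Integrable (fun x => 2 * δ a * (covariantPart (A x) (u x) (v x) a a).im) μ :=
    (hpart a).im.const_mul _
  have hmean (a : n) : 2 * δ a * (∫ x, covariantPart (A x) (u x) (v x) a a ∂μ).im + δ a ^ 2
      = ∫ x, (2 * δ a * (covariantPart (A x) (u x) (v x) a a).im + δ a ^ 2) ∂μ := by
    have hre := integral_im (hpart a)
    simp only [RCLike.im_to_complex] at hre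
    rw [integral_add (him a) (integrable_const _), integral_const_mul, hre, integral_const,
      probReal_univ, one_smul]
  have hshift (a : n) : Integrable
      (fun x => 2 * δ a * (covariantPart (A x) (u x) (v x) a a).im + δ a ^ 2) μ :=
    (him a).add (integrable_const _)
  simp only [hmean]
  rw [← integral_finsetSum _ fun a _ => hshift a,
    ← integral_add (MatrixMemL2.covariantDeriv hu hA hv).integrable_frobSq
      (integrable_finsetSum _ fun a _ => hshift a)]
  refine integral_congr_ae ?_
  filter_upwards [hu', hv'] with x hux hvx
  rw [hux, hvx, frobSq_covariantDeriv_mul_diagonal (hu.mem_unitaryGroup x) (hD x)]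

/-- The shift of the square of the covariant derivative cancels that of the squared averages. -/
lemma gaugeEnergy_mul_diagonal (hu : IsUnitaryField μ u) (hA : MatrixMemL2 μ A)
    (hv : MatrixMemL2 μ v) (hD : ∀ x a, star (D x a) * D x a = 1)
    (hu' : ∀ᵐ x ∂μ, u' x = u x * Matrix.diagonal (D x))
    (hv' : ∀ᵐ x ∂μ, v' x = (v x + u x * Matrix.diagonal fun a => Complex.I * δ a)
      * Matrix.diagonal (D x)) :
    gaugeEnergy μ A u' v' = gaugeEnergy μ A u v := by
  rw [gaugeEnergy, gaugeEnergy, integral_frobSq_covariantDeriv_mul_diagonal hu hA hv hD hu' hv',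
    add_assoc, ← Finset.sum_add_distrib]
  congr 1
  refine Finset.sum_congr rfl fun a _ => ?_
  rw [integral_covariantPart_mul_diagonal hu hA hv hD hu' hv' a]
  simp only [sq, Complex.mul_re, Complex.mul_im, Complex.add_re, Complex.add_im, Complex.I_re,
    Complex.I_im, Complex.ofReal_re, Complex.ofReal_im]
  ring

end GaugeChange

end Energy

section CellMeasure

variable {d : ℕ} (b : Module.Basis (Fin d) ℝ (Eu d))

/-- The normalized Lebesgue measure on the fundamental cell of the dual lattice. -/
def cellMeasure : Measure (Eu d) := ProbabilityTheory.cond volume (dualCell b)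

lemma setAverage_dualCell_eq (f : Eu d → ℂ) :
    ⨍ k in dualCell b, f k = ∫ k, f k ∂(cellMeasure b) :=
  setAverage_eq' volume f (dualCell b)

lemma setIntegral_dualCell_eq (f : Eu d → ℝ) :
    ∫ k in dualCell b, f k = volume.real (dualCell b) * ∫ k, f k ∂(cellMeasure b) := by
  rw [← measure_smul_setAverage f (isCompact_dualCell b).measure_ne_top, smul_eq_mul,
    setAverage_eq']
  rfl

instance : IsProbabilityMeasure (cellMeasure b) :=
  ProbabilityTheory.cond_isProbabilityMeasure_of_finite (volume_dualCell_ne_zero b)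
    (isCompact_dualCell b).measure_ne_top

variable {b}

lemma ae_cellMeasure {p : Eu d → Prop} (h : ∀ᵐ k ∂(volume.restrict (dualCell b)), p k) :
    ∀ᵐ k ∂(cellMeasure b), p k :=
  Measure.ae_smul_measure h _

lemma ae_cellMeasure_of_ae {p : Eu d → Prop} (h : ∀ᵐ k : Eu d, p k) :
    ∀ᵐ k ∂(cellMeasure b), p k :=
  ae_cellMeasure (ae_restrict_of_ae h)

lemma MemL2loc.memLp_cellMeasure {F : Type*} [NormedAddCommGroup F] {u : Eu d → F}
    (hu : MemL2loc u) : MemLp u 2 (cellMeasure b) :=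
  (hu.2 _ (isCompact_dualCell b)).smul_measure (ENNReal.inv_ne_top.2 (volume_dualCell_ne_zero b))

lemma WeaklyTendsto.cellMeasure {v : ℕ → Eu d → ℂ} {w : Eu d → ℂ}
    (h : WeaklyTendsto (volume.restrict (dualCell b)) v w) : WeaklyTendsto (cellMeasure b) v w :=
  h.smul_measure (ENNReal.inv_ne_zero.2 (isCompact_dualCell b).measure_ne_top)
    (ENNReal.inv_ne_top.2 (volume_dualCell_ne_zero b))

end CellMeasure

/-! ### Gauge transformations -/

section PlaneWave

variable {d : ℕ}

/-- The plane wave `x ↦ exp(i x · ξ)`. -/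
def planeWave (ξ x : Eu d) : ℂ := Complex.exp ((⟪x, ξ⟫_ℝ : ℝ) * Complex.I)

lemma star_planeWave_mul_self (ξ x : Eu d) : star (planeWave ξ x) * planeWave ξ x = 1 := by
  rw [Complex.star_def, ← Complex.normSq_eq_conj_mul_self, Complex.normSq_eq_norm_sq, planeWave,
    Complex.norm_exp_ofReal_mul_I, one_pow, Complex.ofReal_one]

lemma contDiff_planeWave (ξ : Eu d) : ContDiff ℝ ∞ (planeWave ξ) := by
  have hphase : ContDiff ℝ ∞ fun x : Eu d => ((⟪x, ξ⟫_ℝ : ℝ) : ℂ) :=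
    Complex.ofRealCLM.contDiff.comp (contDiff_id.inner ℝ contDiff_const)
  exact (hphase.mul contDiff_const).cexp

lemma fderiv_planeWave_single (ξ x : Eu d) (j : Fin d) :
    fderiv ℝ (planeWave ξ) x (EuclideanSpace.single j 1) = Complex.I * ξ j * planeWave ξ x := by
  have hinner : HasFDerivAt (fun x : Eu d => ⟪x, ξ⟫_ℝ) ((innerSL ℝ).flip ξ) x :=
    ((innerSL ℝ).flip ξ).hasFDerivAt
  have hwave : HasFDerivAt (planeWave ξ) _ x :=
    ((Complex.ofRealCLM.hasFDerivAt.comp x hinner).mul_const Complex.I).cexp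
  have hξ : (innerSL ℝ).flip ξ (EuclideanSpace.single j 1) = ξ j := by
    rw [ContinuousLinearMap.flip_apply, innerSL_apply_apply, EuclideanSpace.inner_single_left]
    simp only [map_one, one_mul]
  rw [hwave.fderiv]
  simp only [planeWave, smul_apply, ContinuousLinearMap.comp_apply, hξ, smul_eq_mul,
    Function.comp_apply, Complex.ofRealCLM_apply]
  ring

variable {F : Type*} [NormedAddCommGroup F] [NormedSpace ℝ F]

lemma MemW12loc.planeWave_smul [NormedSpace ℂ F] [IsScalarTower ℝ ℂ F] [CompleteSpace F]
    {u : Eu d → F} (hu : MemW12loc u) (ξ : Eu d) : MemW12loc fun x => planeWave ξ x • u x := by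
  have hξ := contDiff_planeWave ξ
  refine ⟨hu.1.continuous_smul hξ.continuous, fun j =>
    ⟨_, ?_, (hu.hasWeakPartial j).smooth_smul hξ⟩⟩
  exact (hu.1.continuous_smul (continuous_fderiv_apply_const hξ _)).add
    ((hu.memL2loc_weakPartial j).continuous_smul hξ.continuous)

lemma hasWeakPartial_const [CompleteSpace F] (j : Fin d) (c : F) :
    HasWeakPartial j (fun _ => c) 0 := by
  refine ⟨locallyIntegrable_const c, locallyIntegrable_zero, fun φ hφ hc => ?_⟩
  have hdφ : Integrable (fun x => fderiv ℝ φ x (EuclideanSpace.single j 1)) volume :=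
    (continuous_fderiv_apply_const hφ _).integrable_of_hasCompactSupport
      (hc.fderiv_apply (𝕜 := ℝ) _)
  have hφ' : Integrable φ volume := hφ.continuous.integrable_of_hasCompactSupport hc
  have hparts := integral_mul_fderiv_eq_neg_fderiv_mul_of_integrable (𝕜 := ℝ) (μ := volume)
    (f := fun _ : Eu d => (1 : ℝ)) (g := φ) (v := EuclideanSpace.single j (1 : ℝ)) (by simp)
    (by simpa only [one_mul] using hdφ) (by simpa only [one_mul] using hφ') (by fun_prop)
    (fun x _ => hφ.differentiable (by simp) x)
  simp only [one_mul, fderiv_fun_const, Pi.zero_apply, zero_apply, zero_mul, integral_zero,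
    neg_zero] at hparts
  rw [integral_smul_const, hparts]
  simp

lemma memW12loc_const [CompleteSpace F] (c : F) : MemW12loc fun _ : Eu d => c :=
  ⟨memL2loc_of_continuous continuous_const, fun j =>
    ⟨0, memL2loc_of_continuous continuous_const, hasWeakPartial_const j c⟩⟩

end PlaneWave

section Gauge

variable {d m : ℕ} {b : Module.Basis (Fin d) ℝ (Eu d)}

/-- The gauge-dependent part of the localization functional, with the contributions of the
directions completed to squares, for an arbitrary connection `A` in place of the Berry
connection. -/
def gaugeFunctional (b : Module.Basis (Fin d) ℝ (Eu d))
    (A : Fin d → Eu d → Matrix (Fin m) (Fin m) ℂ)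
    (U : DualTorus b → Matrix.unitaryGroup (Fin m) ℂ) : ℝ :=
  ∑ j, gaugeEnergy (cellMeasure b) (A j) (gaugeLift b U) (gaugePartial b j U)

variable {U : DualTorus b → Matrix.unitaryGroup (Fin m) ℂ}
  {A : Fin d → Eu d → Matrix (Fin m) (Fin m) ℂ}

lemma one_mem_gaugeSpace : 1 ∈ gaugeSpace b m := fun _ _ => memW12loc_const _

lemma gaugeLift_add (U : DualTorus b → Matrix.unitaryGroup (Fin m) ℂ) (k : Eu d)
    (l : dualLattice b) : gaugeLift b U (k + l) = gaugeLift b U k := by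
  have hk : ((k + l : Eu d) : DualTorus b) = k := by simp
  rw [gaugeLift, gaugeLift, hk]

lemma isPeriodicSobolev_gaugeLift (hU : U ∈ gaugeSpace b m) (p q : Fin m) :
    IsPeriodicSobolev b (fun k => gaugeLift b U k p q) (fun j k => gaugePartial b j U k p q) where
  periodic k l := by rw [gaugeLift_add]
  memL2loc := (hU p q).1
  memL2loc_partial := (hU p q).memL2loc_weakPartial
  hasWeakPartial := (hU p q).hasWeakPartial

lemma isUnitaryField_gaugeLift (hU : U ∈ gaugeSpace b m) :
    IsUnitaryField (cellMeasure b) (gaugeLift b U) where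
  mem_unitaryGroup k := (U k).2
  aestronglyMeasurable p q := (hU p q).1.memLp_cellMeasure.1

lemma matrixMemL2_gaugePartial (hU : U ∈ gaugeSpace b m) (j : Fin d) :
    MatrixMemL2 (cellMeasure b) (gaugePartial b j U) :=
  fun p q => ((hU p q).memL2loc_weakPartial j).memLp_cellMeasure

lemma matrixMemL2_berry {χ : Fin m → Eu d → Hf b}
    (hχ : ∀ᵐ k ∂(volume.restrict (dualCell b)), Orthonormal ℂ fun a => χ a k)
    (hχW : ∀ a, MemW12loc (χ a)) (j : Fin d) :
    MatrixMemL2 (cellMeasure b) (berry b χ j) := by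
  intro p q
  have hpartial := ((hχW q).memL2loc_weakPartial j).memLp_cellMeasure (b := b)
  refine hpartial.of_le ((hχW p).1.memLp_cellMeasure.1.inner hpartial.1) ?_
  filter_upwards [ae_cellMeasure hχ] with k hk
  refine (norm_inner_le_norm (𝕜 := ℂ) (χ p k) (weakPartial j (χ q) k)).trans ?_
  rw [hk.1 p, one_mul]

/-- The character of the dual torus `ℝ^d / Γ*` defined by the plane wave of a vector of `Γ`. -/
def dualCharacter (γ : lattice b) (y : DualTorus b) : ℂ :=
  Quotient.liftOn' y (planeWave (γ : Eu d)) (by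
    intro k k' hk
    rw [QuotientAddGroup.leftRel_apply] at hk
    obtain ⟨n, hn⟩ := hk _ γ.2
    have hinner : ⟪k', (γ : Eu d)⟫_ℝ = ⟪k, (γ : Eu d)⟫_ℝ + 2 * Real.pi * n := by
      rw [← hn, ← inner_add_left, add_neg_cancel_left]
    refine Complex.exp_eq_exp_iff_exists_int.2 ⟨-n, ?_⟩
    rw [hinner]
    push_cast
    ring)

lemma star_dualCharacter_mul_self (γ : lattice b) (y : DualTorus b) :
    star (dualCharacter γ y) * dualCharacter γ y = 1 := by
  induction y using QuotientAddGroup.induction_on with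
  | H k => exact star_planeWave_mul_self _ k

/-- The diagonal gauge whose entries are the characters of the vectors `γ a` of `Γ`. -/
def diagonalGauge (γ : Fin m → lattice b) (y : DualTorus b) : Matrix.unitaryGroup (Fin m) ℂ :=
  ⟨Matrix.diagonal fun a => dualCharacter (γ a) y,
    diagonal_mem_unitaryGroup fun a => star_dualCharacter_mul_self (γ a) y⟩

lemma gaugeLift_mul_diagonalGauge (U : DualTorus b → Matrix.unitaryGroup (Fin m) ℂ)
    (γ : Fin m → lattice b) (k : Eu d) :
    gaugeLift b (U * diagonalGauge γ) k
      = gaugeLift b U k * Matrix.diagonal fun a => planeWave (γ a : Eu d) k := rfl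

lemma gaugeLift_mul_diagonalGauge_apply (U : DualTorus b → Matrix.unitaryGroup (Fin m) ℂ)
    (γ : Fin m → lattice b) (p a : Fin m) :
    (fun k => gaugeLift b (U * diagonalGauge γ) k p a)
      = fun k => planeWave (γ a : Eu d) k • gaugeLift b U k p a := by
  ext k
  rw [gaugeLift_mul_diagonalGauge, Matrix.mul_diagonal, mul_comm, smul_eq_mul]

lemma mul_diagonalGauge_mem_gaugeSpace (hU : U ∈ gaugeSpace b m) (γ : Fin m → lattice b) :
    U * diagonalGauge γ ∈ gaugeSpace b m := by
  intro p a
  rw [gaugeLift_mul_diagonalGauge_apply]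
  exact (hU p a).planeWave_smul _

lemma gaugePartial_mul_diagonalGauge (hU : U ∈ gaugeSpace b m) (γ : Fin m → lattice b)
    (j : Fin d) :
    ∀ᵐ k : Eu d, gaugePartial b j (U * diagonalGauge γ) k
      = (gaugePartial b j U k
          + gaugeLift b U k * Matrix.diagonal fun a => Complex.I * (γ a : Eu d) j)
        * Matrix.diagonal fun a => planeWave (γ a : Eu d) k := by
  have hpartial (p a : Fin m) :=
    (((hU p a).hasWeakPartial j).smooth_smul (contDiff_planeWave (γ a : Eu d))).weakPartial_ae_eq
  simp only [← gaugeLift_mul_diagonalGauge_apply] at hpartial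
  filter_upwards [ae_all_iff.2 fun p => ae_all_iff.2 (hpartial p)] with k hk
  ext p a
  rw [Matrix.mul_diagonal, Matrix.add_apply, Matrix.mul_diagonal]
  refine (hk p a).trans ?_
  rw [fderiv_planeWave_single, gaugePartial, Matrix.of_apply, smul_eq_mul, smul_eq_mul]
  ring

lemma gaugeFunctional_mul_diagonalGauge (hA : ∀ j, MatrixMemL2 (cellMeasure b) (A j))
    (hU : U ∈ gaugeSpace b m) (γ : Fin m → lattice b) :
    gaugeFunctional b A (U * diagonalGauge γ) = gaugeFunctional b A U :=
  Finset.sum_congr rfl fun j _ =>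
    gaugeEnergy_mul_diagonal (isUnitaryField_gaugeLift hU) (hA j) (matrixMemL2_gaugePartial hU j)
      (fun _ _ => star_planeWave_mul_self _ _)
      (.of_forall fun k => gaugeLift_mul_diagonalGauge U γ k)
      (ae_cellMeasure_of_ae (gaugePartial_mul_diagonalGauge hU γ j))

/-- The integral of the `a`-th diagonal entry of `Uᴴ (∂_j U + A_j U)`, whose square enters the
localization functional. -/
def diagAverage (b : Module.Basis (Fin d) ℝ (Eu d))
    (A : Fin d → Eu d → Matrix (Fin m) (Fin m) ℂ)
    (U : DualTorus b → Matrix.unitaryGroup (Fin m) ℂ) (j : Fin d) (a : Fin m) : ℂ :=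
  ∫ k, covariantPart (A j k) (gaugeLift b U k) (gaugePartial b j U k) a a ∂(cellMeasure b)

lemma diagAverage_mul_diagonalGauge (hA : ∀ j, MatrixMemL2 (cellMeasure b) (A j))
    (hU : U ∈ gaugeSpace b m) (γ : Fin m → lattice b) (j : Fin d) (a : Fin m) :
    diagAverage b A (U * diagonalGauge γ) j a
      = diagAverage b A U j a + Complex.I * (γ a : Eu d) j :=
  integral_covariantPart_mul_diagonal (isUnitaryField_gaugeLift hU) (hA j)
    (matrixMemL2_gaugePartial hU j) (fun _ _ => star_planeWave_mul_self _ _)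
    (.of_forall fun k => gaugeLift_mul_diagonalGauge U γ k)
    (ae_cellMeasure_of_ae (gaugePartial_mul_diagonalGauge hU γ j)) a

/- The averages of the `a`-th diagonal entry form a vector, which a translation by a vector of `Γ`
moves into the fundamental cell of `Γ`. -/
lemma exists_abs_im_diagAverage_mul_diagonalGauge_le
    (hA : ∀ j, MatrixMemL2 (cellMeasure b) (A j)) (hU : U ∈ gaugeSpace b m) :
    ∃ γ : Fin m → lattice b, ∀ j a,
      |(diagAverage b A (U * diagonalGauge γ) j a).im| ≤ ∑ i, ‖b i‖ := by
  let w (a : Fin m) : Eu d := WithLp.toLp 2 fun j => (diagAverage b A U j a).im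
  refine ⟨fun a => -⟨ZSpan.floor b (w a), (ZSpan.floor b (w a)).2⟩, fun j a => ?_⟩
  have hfract : (diagAverage b A U j a + Complex.I * ((-(ZSpan.floor b (w a) : Eu d)) j : ℝ)).im
      = ZSpan.fract b (w a) j := by
    rw [ZSpan.fract_apply]
    simp [w, sub_eq_add_neg]
  rw [diagAverage_mul_diagonalGauge hA hU]
  refine (congrArg abs hfract).trans_le ?_
  rw [← Real.norm_eq_abs]
  exact (PiLp.norm_apply_le _ j).trans (ZSpan.norm_fract_le b (w a))

lemma exists_gauge_sum_integral_frobSq_gaugePartial_le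
    (hA : ∀ j, MatrixMemL2 (cellMeasure b) (A j)) :
    ∃ K : ℝ, ∀ U ∈ gaugeSpace b m, ∃ V ∈ gaugeSpace b m,
      gaugeFunctional b A V = gaugeFunctional b A U ∧
      ∑ j, ∫ k, frobSq (gaugePartial b j V k) ∂(cellMeasure b)
        ≤ 2 * (gaugeFunctional b A U + K) := by
  refine ⟨∑ j, (m * (∑ i, ‖b i‖) ^ 2 + ∫ k, frobSq (skewPart (A j k)) ∂(cellMeasure b)),
    fun U hU => ?_⟩
  obtain ⟨γ, hγ⟩ := exists_abs_im_diagAverage_mul_diagonalGauge_le hA hU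
  have hV := mul_diagonalGauge_mem_gaugeSpace hU γ
  have hinv := gaugeFunctional_mul_diagonalGauge hA hU γ
  refine ⟨_, hV, hinv, ?_⟩
  rw [← hinv, gaugeFunctional, ← Finset.sum_add_distrib, Finset.mul_sum]
  refine Finset.sum_le_sum fun j _ => ?_
  have hbound := integral_frobSq_le_gaugeEnergy (isUnitaryField_gaugeLift hV) (hA j)
    (matrixMemL2_gaugePartial hV j) (hγ j)
  rw [Fintype.card_fin] at hbound
  linarith

lemma tendsto_gaugeLift_limUnder {U : ℕ → DualTorus b → Matrix.unitaryGroup (Fin m) ℂ} {k : Eu d}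
    {L : Fin m → Fin m → ℂ}
    (h : ∀ p q, Tendsto (fun n => gaugeLift b (U n) k p q) atTop (𝓝 (L p q))) (p q : Fin m) :
    Tendsto (fun n => gaugeLift b (U n) k p q) atTop
      (𝓝 (gaugeLift b (fun y => limUnder atTop fun n => U n y) k p q)) := by
  have hlim : Tendsto (fun n => (U n k).1) atTop (𝓝 (Matrix.of L)) :=
    tendsto_pi_nhds.2 fun p => tendsto_pi_nhds.2 (h p)
  have hL : Matrix.of L ∈ Matrix.unitaryGroup (Fin m) ℂ :=
    isClosed_unitary.mem_of_tendsto hlim (.of_forall fun n => (U n k).2)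
  have hU : Tendsto (fun n => U n k) atTop (𝓝 (limUnder atTop fun n => U n k)) :=
    tendsto_nhds_limUnder ⟨⟨_, hL⟩, tendsto_subtype_rng.2 hlim⟩
  exact tendsto_pi_nhds.1 (tendsto_pi_nhds.1 (tendsto_subtype_rng.1 hU) p) q

end Gauge

/-! ### The direct method -/

section Minimization

variable {d m : ℕ} {b : Module.Basis (Fin d) ℝ (Eu d)}
  {A : Fin d → Eu d → Matrix (Fin m) (Fin m) ℂ}

lemma setIntegral_norm_sq_gaugeLift_le {U : DualTorus b → Matrix.unitaryGroup (Fin m) ℂ}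
    (hU : U ∈ gaugeSpace b m) (p q : Fin m) :
    ∫ k in dualCell b, ‖gaugeLift b U k p q‖ ^ 2 ≤ volume.real (dualCell b) := by
  have hone : ∫ k, ‖gaugeLift b U k p q‖ ^ 2 ∂(cellMeasure b) ≤ ∫ _, 1 ∂(cellMeasure b) :=
    integral_mono (integrable_norm_sq (hU p q).1.memLp_cellMeasure) (integrable_const _)
      fun k => pow_le_one₀ (norm_nonneg _) ((isUnitaryField_gaugeLift hU).norm_apply_le k p q)
  rw [setIntegral_dualCell_eq]
  exact mul_le_of_le_one_right measureReal_nonneg (hone.trans_eq (by simp))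

lemma setIntegral_norm_sq_gaugePartial_le {U : DualTorus b → Matrix.unitaryGroup (Fin m) ℂ}
    (hU : U ∈ gaugeSpace b m) (j : Fin d) (p q : Fin m) :
    ∫ k in dualCell b, ‖gaugePartial b j U k p q‖ ^ 2
      ≤ volume.real (dualCell b) * ∫ k, frobSq (gaugePartial b j U k) ∂(cellMeasure b) := by
  rw [setIntegral_dualCell_eq]
  exact mul_le_mul_of_nonneg_left
    ((matrixMemL2_gaugePartial hU j).integral_norm_sq_apply_le p q) measureReal_nonneg

lemma exists_gaugeLift_ae_eq_of_tendsto {U : ℕ → DualTorus b → Matrix.unitaryGroup (Fin m) ℂ}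
    {u : Fin m × Fin m → Eu d → ℂ}
    (h : ∀ᵐ k : Eu d, ∀ i, Tendsto (fun n => gaugeLift b (U n) k i.1 i.2) atTop (𝓝 (u i k))) :
    ∃ V : DualTorus b → Matrix.unitaryGroup (Fin m) ℂ,
      ∀ p q, u (p, q) =ᵐ[volume] fun k => gaugeLift b V k p q := by
  refine ⟨fun y => limUnder atTop fun n => U n y, fun p q => ?_⟩
  filter_upwards [h] with k hk
  exact tendsto_nhds_unique (hk (p, q))
    (tendsto_gaugeLift_limUnder (fun p q => hk (p, q)) p q)

lemma exists_gauge_tendsto_ae_subseq {U : ℕ → DualTorus b → Matrix.unitaryGroup (Fin m) ℂ}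
    (hU : ∀ n, U n ∈ gaugeSpace b m) {C : ℝ}
    (hC : ∀ n j, ∫ k, frobSq (gaugePartial b j (U n) k) ∂(cellMeasure b) ≤ C) :
    ∃ φ : ℕ → ℕ, StrictMono φ ∧ ∃ V ∈ gaugeSpace b m,
      (∀ᵐ k : Eu d, ∀ p q,
        Tendsto (fun n => gaugeLift b (U (φ n)) k p q) atTop (𝓝 (gaugeLift b V k p q))) ∧
      ∀ j p q, WeaklyTendsto (cellMeasure b) (fun n k => gaugePartial b j (U (φ n)) k p q)
        (fun k => gaugePartial b j V k p q) := by
  obtain ⟨φ, hφ, u, v, huv, hae, hweak⟩ := exists_isPeriodicSobolev_tendsto_ae_subseq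
    (C := max (volume.real (dualCell b)) (volume.real (dualCell b) * C))
    (fun (i : Fin m × Fin m) n => isPeriodicSobolev_gaugeLift (hU n) i.1 i.2)
    (fun i n => (setIntegral_norm_sq_gaugeLift_le (hU n) i.1 i.2).trans (le_max_left _ _))
    (fun i n j => ((setIntegral_norm_sq_gaugePartial_le (hU n) j i.1 i.2).trans
      (mul_le_mul_of_nonneg_left (hC n j) measureReal_nonneg)).trans (le_max_right _ _))
  obtain ⟨V, huV⟩ := exists_gaugeLift_ae_eq_of_tendsto hae
  have hVv (p q : Fin m) (j : Fin d) :
      HasWeakPartial j (fun k => gaugeLift b V k p q) (v (p, q) j) :=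
    ((huv (p, q)).hasWeakPartial j).congr_left (huV p q)
  refine ⟨φ, hφ, V, fun p q => ⟨(huv (p, q)).memL2loc.congr (huV p q), fun j =>
    ⟨_, (huv (p, q)).memL2loc_partial j, hVv p q j⟩⟩, ?_, fun j p q => ?_⟩
  · filter_upwards [hae, ae_all_iff.2 fun p => ae_all_iff.2 (huV p)] with k hk huVk p q
    exact huVk p q ▸ hk (p, q)
  · exact (hweak (p, q) j).cellMeasure.congr (fun _ => .of_forall fun _ => rfl)
      (ae_cellMeasure_of_ae (hVv p q j).weakPartial_ae_eq.symm)

lemma gaugeFunctional_le_of_tendsto (hA : ∀ j, MatrixMemL2 (cellMeasure b) (A j))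
    {U : ℕ → DualTorus b → Matrix.unitaryGroup (Fin m) ℂ} (hU : ∀ n, U n ∈ gaugeSpace b m)
    {V : DualTorus b → Matrix.unitaryGroup (Fin m) ℂ} (hV : V ∈ gaugeSpace b m) {C I : ℝ}
    (hC : ∀ n j, ∫ k, frobSq (gaugePartial b j (U n) k) ∂(cellMeasure b) ≤ C)
    (hUV : ∀ᵐ k : Eu d, ∀ p q,
      Tendsto (fun n => gaugeLift b (U n) k p q) atTop (𝓝 (gaugeLift b V k p q)))
    (hweak : ∀ j p q, WeaklyTendsto (cellMeasure b) (fun n k => gaugePartial b j (U n) k p q)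
      (fun k => gaugePartial b j V k p q))
    (hI : Tendsto (fun n => gaugeFunctional b A (U n)) atTop (𝓝 I)) :
    gaugeFunctional b A V ≤ I := by
  choose l hl hlim using fun j => exists_tendsto_le_gaugeEnergy (hA j)
    (fun n => isUnitaryField_gaugeLift (hU n)) (fun n => matrixMemL2_gaugePartial (hU n) j)
    (isUnitaryField_gaugeLift hV) (matrixMemL2_gaugePartial hV j) (fun n => hC n j)
    (ae_cellMeasure_of_ae hUV) (hweak j)
  exact le_of_tendsto_of_tendsto' (tendsto_finsetSum Finset.univ fun j _ => hlim j) hI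
    fun n => Finset.sum_le_sum fun j _ => hl j n

lemma exists_isMinOn_gaugeFunctional (hA : ∀ j, MatrixMemL2 (cellMeasure b) (A j)) :
    ∃ U ∈ gaugeSpace b m, IsMinOn (gaugeFunctional b A) (gaugeSpace b m) U := by
  obtain ⟨K, hK⟩ := exists_gauge_sum_integral_frobSq_gaugePartial_le hA
  have hnonneg (V : DualTorus b → Matrix.unitaryGroup (Fin m) ℂ) (j : Fin d) :
      0 ≤ ∫ k, frobSq (gaugePartial b j V k) ∂(cellMeasure b) :=
    integral_nonneg fun k => frobSq_nonneg _
  have hbdd : BddBelow (gaugeFunctional b A '' gaugeSpace b m) := by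
    refine ⟨-K, ?_⟩
    rintro _ ⟨U, hU, rfl⟩
    obtain ⟨V, -, -, hle⟩ := hK U hU
    linarith [Finset.sum_nonneg fun j (_ : j ∈ Finset.univ) => hnonneg V j]
  obtain ⟨s, -, hs, hsU⟩ := exists_seq_tendsto_sInf
    (Set.Nonempty.image (gaugeFunctional b A) ⟨1, one_mem_gaugeSpace⟩) hbdd
  choose U hU hUs using hsU
  choose V hV hVU hVle using fun n => hK (U n) (hU n)
  obtain ⟨M, hM⟩ := hs.bddAbove_range
  have hC (n : ℕ) (j : Fin d) :
      ∫ k, frobSq (gaugePartial b j (V n) k) ∂(cellMeasure b) ≤ 2 * (M + K) := by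
    have hsingle := Finset.single_le_sum (fun j _ => hnonneg (V n) j) (Finset.mem_univ j)
    linarith [hVle n, hUs n, hM ⟨n, rfl⟩]
  obtain ⟨φ, hφ, W, hW, hae, hweak⟩ := exists_gauge_tendsto_ae_subseq hV hC
  have hVs : Tendsto (fun n => gaugeFunctional b A (V n)) atTop
      (𝓝 (sInf (gaugeFunctional b A '' gaugeSpace b m))) :=
    hs.congr fun n => by rw [hVU, hUs]
  have hWle := gaugeFunctional_le_of_tendsto hA (fun n => hV (φ n)) hW (fun n => hC (φ n)) hae
    hweak (hVs.comp hφ.tendsto_atTop)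
  exact ⟨W, hW, fun U hU => hWle.trans (csInf_le hbdd ⟨U, hU, rfl⟩)⟩

lemma mvFunctional_eq_gaugeFunctional_add {χ : Fin m → Eu d → Hf b}
    (hχ : ∀ᵐ k ∂(volume.restrict (dualCell b)), Orthonormal ℂ fun a => χ a k)
    (hχW : ∀ a, MemW12loc (χ a)) {U : DualTorus b → Matrix.unitaryGroup (Fin m) ℂ}
    (hU : U ∈ gaugeSpace b m) :
    mvFunctional b χ U = gaugeFunctional b (berry b χ) U
      + ∑ j, ((∫ k, (m : ℂ) * ∑ a, ((‖weakPartial j (χ a) k‖ ^ 2 : ℝ) : ℂ) ∂(cellMeasure b)).re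
        - ∫ k, frobSq (skewPart (berry b χ j k)) ∂(cellMeasure b)) := by
  have hchi (j : Fin d) :
      Integrable (fun k => (m : ℂ) * ∑ a, ((‖weakPartial j (χ a) k‖ ^ 2 : ℝ) : ℂ))
        (cellMeasure b) :=
    (integrable_finsetSum _ fun a _ => (integrable_norm_sq
      ((hχW a).memL2loc_weakPartial j).memLp_cellMeasure).ofReal).const_mul _
  have hsplit (j : Fin d) := integral_add
    ((matrixMemL2_gaugePartial hU j).conjTranspose.integrable_trace_mul
      (matrixMemL2_gaugePartial hU j)) (hchi j)
  have hsquare (j : Fin d) := re_integral_trace_add_eq (isUnitaryField_gaugeLift hU)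
    (matrixMemL2_berry hχ hχW j) (matrixMemL2_gaugePartial hU j)
  simp only [mvFunctional, mvFormula, setAverage_dualCell_eq, hsplit]
  rw [Finset.sum_comm (s := Finset.univ (α := Fin m)), ← Finset.sum_add_distrib,
    ← Finset.sum_add_distrib, Complex.re_sum, gaugeFunctional, ← Finset.sum_add_distrib]
  refine Finset.sum_congr rfl fun j _ => ?_
  have hj := hsquare j
  simp only [gaugeEnergy, covariantPart, Complex.add_re, Complex.re_sum] at hj ⊢
  linarith

end Minimization

end BlochMV

end

theorem mainTheorem3_general {d m : ℕ} (b : Module.Basis (Fin d) ℝ (BlochMV.Eu d))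
    (χ : Fin m → BlochMV.Eu d → BlochMV.Hf b)
    (hχ : ∀ᵐ k ∂(volume.restrict (BlochMV.dualCell b)), Orthonormal ℂ fun a => χ a k)
    (hχW : ∀ a, BlochMV.MemW12loc (χ a)) :
    ∃ U ∈ BlochMV.gaugeSpace b m,
      IsMinOn (BlochMV.mvFunctional b χ) (BlochMV.gaugeSpace b m) U := by
  obtain ⟨U, hU, hmin⟩ :=
    BlochMV.exists_isMinOn_gaugeFunctional (BlochMV.matrixMemL2_berry hχ hχW)
  refine ⟨U, hU, isMinOn_iff.2 fun V hV => ?_⟩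
  have hle := isMinOn_iff.1 hmin V hV
  rw [BlochMV.mvFunctional_eq_gaugeFunctional_add hχ hχW hU,
    BlochMV.mvFunctional_eq_gaugeFunctional_add hχ hχW hV]
  gcongr

theorem mainTheorem3 {d m : ℕ} (b : Module.Basis (Fin d) ℝ (BlochMV.Eu d))
    (P : BlochMV.Eu d → (BlochMV.Hf b →L[ℂ] BlochMV.Hf b))
    (hP : BlochMV.IsProjectorFamily b m P)
    (hP1 : BlochMV.HasAnalyticExtension b P)
    (hP2 : BlochMV.IsTauCovariant b P)
    (χ : Fin m → BlochMV.Eu d → BlochMV.Hf b)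
    (hχ : BlochMV.IsBlochFrame b P χ)
    (hχW : ∀ a, BlochMV.MemWtilde b (χ a)) :
    ∃ U ∈ BlochMV.gaugeSpace b m,
      IsMinOn (BlochMV.mvFunctional b χ) (BlochMV.gaugeSpace b m) U :=
  mainTheorem3_general b χ (hχ.2.mono fun _ h => h.2.1) fun a => (hχW a).2.2
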